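/- Let $T>0$, $\lambda>0$, $c_0\ge 0$, $\varphi_0>0$ and $\varphi_1\in\mathbb R$ with $\varphi_0+\varphi_1c_0>0$ (so that $\varphi_0+\varphi_1c_0e^{-\lambda u}$, $u\ge 0$, stays between two positive constants), and put $$b(x,y)=-\varphi_1\lambda c_0\,\frac{e^{-\lambda x}\,y}{\varphi_0+\varphi_1c_0e^{-\lambda x}} .$$ Let $K:\mathbb R\to[0,\infty)$ be a smooth probability density such that $K,K',K''$ are bounded and $K,K'$ are Lipschitz, and let $\rho_0\in L^2(\mathbb R)\cap C_b(\mathbb R)$ be a probability density with $\int x^2\rho_0(x)\,dx<\infty$. For a measure $\mu$ on $\mathbb R^2$ let $\Phi(\mu)$ be the measure on $\mathbb R$ with $\int f\,d\Phi(\mu)=\int e^{-y}f(x)\,\mu(dx,dy)$ for bounded continuous $f$, and write $f*\nu(x)=\int f(x-y)\,\nu(dy)$. Consider, for $t\in[0,T]$, the McKean–Vlasov system $$\widetilde X_t=X_0+\int_0^t b\Big(\int_0^sK*\Phi(\widetilde\mu_r)(\widetilde X_s)\,dr,\int_0^sK'*\Phi(\widetilde\mu_r)(\widetilde X_s)\,dr\Big)ds+\sqrt2\,W_t,$$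 $$\widetilde\Lambda_t=\int_0^t\lambda c_0\exp\Big(-\lambda\int_0^sK*\Phi(\widetilde\mu_r)(\widetilde X_s)\,dr\Big)ds,$$ where $\widetilde\mu$ is the law of $(\widetilde X,\widetilde\Lambda)$ on $C([0,T];\mathbb R^2)$ and $\widetilde\mu_r$ is its marginal at time $r$. Here $W$ is a Brownian motion on $[0,T]$ relative to a filtration $\mathbb F=(\mathcal F_t)_{t\in[0,T]}$ on a probability space, and $X_0$ is $\mathcal F_0$-measurable with law $\rho_0(x)\,dx$. A solution is a continuous $\mathbb F$-adapted process $(\widetilde X,\widetilde\Lambda)$ whose law on path space has finite second moment and which satisfies the two equations almost surely for all $t\in[0,T]$. It is a strong solution if it is moreover adapted to the augmented filtration generated by $X_0$ and $W$. A weak solution is a solution on some filtered probability space with some such $W$ and $X_0$. Then: 1. (Strong existence) On every filtered probability space, for every such $W$ and $X_0$, there is a strong solution. 2. (Pathwise uniqueness) Any two solutions on the same probability space with the same $W$ and $X_0$, possibly adapted to different filtrations (for each of which $W$ is a Brownian motion and $X_0$ is measurable at time $0$), are almost surely equal at all times $t\in[0,T]$. 3. (Weak existence) There is a weak solution. 4.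 (Uniqueness in law) Any two weak solutions, possibly on different probability spaces, have the same law on $C([0,T];\mathbb R^2)$. -/

import Mathlib

open MeasureTheory ProbabilityTheory Set
open scoped NNReal ENNReal

universe u v

noncomputable section

namespace KilledMcKeanVlasov

/-- The space `C([0,T]; E)` of continuous paths, with the topology of uniform convergence. -/
abbrev PathSpace (T : ℝ) (E : Type*) [TopologicalSpace E] : Type _ := C(Icc (0 : ℝ) T, E)

/-- Path space carries its Borel σ-algebra. -/
instance instMeasurableSpacePathSpace (T : ℝ) (E : Type*) [TopologicalSpace E] :
    MeasurableSpace (PathSpace T E) := borel _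

instance instBorelSpacePathSpace (T : ℝ) (E : Type*) [TopologicalSpace E] :
    BorelSpace (PathSpace T E) := ⟨rfl⟩

/-- Smooth mollifiers on `ℝ`: smooth probability densities, bounded together with their first and
second derivatives, Lipschitz together with their first derivative. -/
structure IsSmoothMollifier (K : ℝ → ℝ) : Prop where
  nonneg : ∀ y, 0 ≤ K y
  smooth : ContDiff ℝ ((⊤ : ℕ∞) : WithTop ℕ∞) K
  bounded : ∃ M : ℝ, ∀ y, |K y| ≤ M
  deriv_bounded : ∃ M : ℝ, ∀ y, |deriv K y| ≤ M
  deriv_deriv_bounded : ∃ M : ℝ, ∀ y, |deriv (deriv K) y| ≤ M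
  lipschitz : ∃ L : ℝ≥0, LipschitzWith L K
  deriv_lipschitz : ∃ L : ℝ≥0, LipschitzWith L (deriv K)
  integrable : Integrable K
  integral_eq_one : ∫ y, K y = 1

/-- The admissible initial densities: probability densities in `L²(ℝ) ∩ C_b(ℝ)` with finite second
moment. -/
structure IsInitialDensity (ρ : ℝ → ℝ) : Prop where
  nonneg : ∀ x, 0 ≤ ρ x
  continuous : Continuous ρ
  bounded : ∃ M : ℝ, ∀ x, ρ x ≤ M
  memLp_two : MemLp ρ 2
  integrable : Integrable ρ
  integral_eq_one : ∫ x, ρ x = 1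
  second_moment : Integrable (fun x => x ^ 2 * ρ x)

/-- The probability measure `ρ(x) dx` on `ℝ`. -/
def densityMeasure (ρ : ℝ → ℝ) : Measure ℝ :=
  volume.withDensity (fun x => ENNReal.ofReal (ρ x))

/-- The data of the model: the time horizon `T`, the parameters `λ, c₀, φ₀, φ₁` and the kernel `K`.
Given `φ₀ > 0`, the condition `φ₀ + φ₁ c₀ > 0` says that `φ₀ + φ₁ c₀ exp (-λ u)`, `u ≥ 0`, stays
between two positive constants. -/
structure Model where
  T : ℝ
  lam : ℝ
  c0 : ℝ
  phi0 : ℝ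
  phi1 : ℝ
  K : ℝ → ℝ
  T_pos : 0 < T
  lam_pos : 0 < lam
  c0_nonneg : 0 ≤ c0
  phi0_pos : 0 < phi0
  denominator_pos : 0 < phi0 + phi1 * c0
  mollifier : IsSmoothMollifier K

namespace Model

variable (M : Model)

/-- The advection term `b(x, y)`. -/
def b (x y : ℝ) : ℝ :=
  -(M.phi1 * M.lam * M.c0) *
    (Real.exp (-M.lam * x) * y / (M.phi0 + M.phi1 * M.c0 * Real.exp (-M.lam * x)))

/-- The reaction term `c(x)`. -/
def c (x : ℝ) : ℝ := M.lam * M.c0 * Real.exp (-M.lam * x)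

/-- Time `0` as an element of `[0,T]`. -/
def zero : Icc (0 : ℝ) M.T := ⟨0, le_rfl, M.T_pos.le⟩

/-- A real time seen as an element of `[0,T]`; only used at times that do lie in `[0,T]`. -/
def time (r : ℝ) : Icc (0 : ℝ) M.T := projIcc 0 M.T M.T_pos.le r

end Model

/-- The measure `Φ(μ)` on `ℝ`: the first marginal of `e^{-y} μ(dx, dy)`. -/
def Phi (μ : Measure (ℝ × ℝ)) : Measure ℝ :=
  (μ.withDensity (fun p => ENNReal.ofReal (Real.exp (-p.2)))).map Prod.fst

/-- The defining property of `Φ`. -/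
theorem integral_Phi (μ : Measure (ℝ × ℝ)) (f : ℝ → ℝ) (hf : Continuous f) :
    ∫ x, f x ∂(Phi μ) = ∫ p : ℝ × ℝ, Real.exp (-p.2) * f p.1 ∂μ := by
  have hm : Measurable fun p : ℝ × ℝ => ENNReal.ofReal (Real.exp (-p.2)) := by fun_prop
  rw [Phi, integral_map measurable_fst.aemeasurable hf.aestronglyMeasurable,
    integral_withDensity_eq_integral_toReal_smul hm (by simp)]
  simp [ENNReal.toReal_ofReal, Real.exp_nonneg]

/-- The convolution `f * ν (x) = ∫ f(x - y) ν(dy)` of a function with a measure. -/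
def conv (f : ℝ → ℝ) (ν : Measure ℝ) (x : ℝ) : ℝ := ∫ y, f (x - y) ∂ν

/-- The time marginal at `t` of a measure on path space. -/
def marginal {T : ℝ} (μ : Measure (PathSpace T (ℝ × ℝ))) (t : Icc (0 : ℝ) T) :
    Measure (ℝ × ℝ) := μ.map (fun x => x t)

namespace Model

variable (M : Model)

/-- `∫₀ˢ f * Φ(μ_r)(x) dr`, for a measure `μ` on path space with time marginals `μ_r`. -/
def timeConv (f : ℝ → ℝ) (μ : Measure (PathSpace M.T (ℝ × ℝ))) (s x : ℝ) : ℝ :=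
  ∫ r in (0 : ℝ)..s, conv f (Phi (marginal μ (M.time r))) x

/-- The drift of the lifted system at time `s` and position `x`, in the environment `μ`. -/
def drift (μ : Measure (PathSpace M.T (ℝ × ℝ))) (s x : ℝ) : ℝ :=
  M.b (M.timeConv M.K μ s x) (M.timeConv (deriv M.K) μ s x)

/-- The rate of the lifted system at time `s` and position `x`, in the environment `μ`. -/
def rate (μ : Measure (PathSpace M.T (ℝ × ℝ))) (s x : ℝ) : ℝ :=
  M.c (M.timeConv M.K μ s x)

end Model

/-- Square integrability of a measure on path space. -/
def HasFiniteSecondMoment {T : ℝ} (μ : Measure (PathSpace T (ℝ × ℝ))) : Prop :=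
  ∫⁻ x, ‖x‖ₑ ^ 2 ∂μ < ∞

section Solutions

variable (M : Model) {Ω : Type*} {mΩ : MeasurableSpace Ω} (P : Measure Ω)

/-- `W` is a standard Brownian motion on `[0,T]` relative to the filtration `𝓕`. -/
structure IsBrownianMotion
    (𝓕 : Filtration (Icc (0 : ℝ) M.T) mΩ)
    (W : Ω → PathSpace M.T ℝ) : Prop where
  adapted : ∀ t, Measurable[𝓕 t] (fun ω => W ω t)
  zero : ∀ᵐ ω ∂P, W ω M.zero = 0
  increments : ∀ s t : Icc (0 : ℝ) M.T, s ≤ t →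
    HasLaw (fun ω => W ω t - W ω s) (gaussianReal 0 (Real.toNNReal ((t : ℝ) - (s : ℝ)))) P
  indep : ∀ s t : Icc (0 : ℝ) M.T, s ≤ t →
    Indep (𝓕 s) (MeasurableSpace.comap (fun ω => W ω t - W ω s) inferInstance) P

/-- The input of the system: a probability space with a filtration `𝓕`, an `𝓕`-Brownian motion `W`
and an `𝓕₀`-measurable initial value `X₀` with law `ρ₀(x) dx`. -/
structure IsInput (ρ₀ : ℝ → ℝ)
    (𝓕 : Filtration (Icc (0 : ℝ) M.T) mΩ)
    (X₀ : Ω → ℝ) (W : Ω → PathSpace M.T ℝ) : Prop where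
  isProbabilityMeasure : IsProbabilityMeasure P
  brownian : IsBrownianMotion M P 𝓕 W
  initial_measurable : Measurable[𝓕 M.zero] X₀
  initial_law : HasLaw X₀ (densityMeasure ρ₀) P

/-- The continuous process `Z = (X, Λ)`, with law `P.map Z` on path space, is adapted to `𝓕` and
solves the lifted McKean–Vlasov system driven by `W` from `X₀`. -/
structure IsSolution
    (𝓕 : Filtration (Icc (0 : ℝ) M.T) mΩ)
    (X₀ : Ω → ℝ) (W : Ω → PathSpace M.T ℝ) (Z : Ω → PathSpace M.T (ℝ × ℝ)) : Prop where
  adapted : ∀ t, Measurable[𝓕 t] (fun ω => Z ω t)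
  measurable : Measurable Z
  second_moment : HasFiniteSecondMoment (P.map Z)
  position : ∀ᵐ ω ∂P, ∀ t : Icc (0 : ℝ) M.T,
    (Z ω t).1 = X₀ ω + (∫ s in (0 : ℝ)..t, M.drift (P.map Z) s (Z ω (M.time s)).1)
      + √2 * W ω t
  clock : ∀ᵐ ω ∂P, ∀ t : Icc (0 : ℝ) M.T,
    (Z ω t).2 = ∫ s in (0 : ℝ)..t, M.rate (P.map Z) s (Z ω (M.time s)).1

/-- The σ-algebra generated by `X₀` and by `W` up to time `t`. -/
@[reducible] def inputSigma (X₀ : Ω → ℝ) (W : Ω → PathSpace M.T ℝ) (t : Icc (0 : ℝ) M.T) :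
    MeasurableSpace Ω :=
  MeasurableSpace.comap X₀ inferInstance ⊔
    ⨆ s : Iic t, MeasurableSpace.comap (fun ω => W ω s) inferInstance

/-- A strong solution: a solution which is, moreover, adapted to the `P`-augmentation of the
filtration generated by `X₀` and `W` (measurability with respect to the augmented σ-algebra is
almost sure equality with a function that is measurable for the original one). -/
structure IsStrongSolution
    (𝓕 : Filtration (Icc (0 : ℝ) M.T) mΩ)
    (X₀ : Ω → ℝ) (W : Ω → PathSpace M.T ℝ) (Z : Ω → PathSpace M.T (ℝ × ℝ)) : Prop
    extends IsSolution M P 𝓕 X₀ W Z where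
  strong : ∀ t, AEStronglyMeasurable[inputSigma M X₀ W t] (fun ω => Z ω t) P

/-- `Z` is (the process component of) a weak solution with initial law `ρ₀(x) dx`: its probability
space carries some filtration, Brownian motion and initial value for which `Z` is a solution. -/
def IsWeakSolution (ρ₀ : ℝ → ℝ) (Z : Ω → PathSpace M.T (ℝ × ℝ)) : Prop :=
  ∃ (𝓕 : Filtration (Icc (0 : ℝ) M.T) mΩ)
    (X₀ : Ω → ℝ) (W : Ω → PathSpace M.T ℝ), IsInput M P ρ₀ 𝓕 X₀ W ∧ IsSolution M P 𝓕 X₀ W Z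

end Solutions

end KilledMcKeanVlasov

end

open KilledMcKeanVlasov

/-!
The noise is additive and does not depend on the state, so the system can be solved path by path,
without stochastic integration. An input is a pair `(x, w)` of an initial value and a driving path,
and a solution is the image of the random input under a continuous map `F` from inputs to paths.

The rate is nonnegative, so the clock never decreases below `0` and the weight `e^{-y}` in `Φ` is at
most `1` along solutions. On laws of this kind (`IsEnvironment`) the drift and the rate are bounded,
and Lipschitz jointly in the position and in the law, the distance of laws being a uniform distance
over couplings with the weight `e^{kt}` (`Model.exists_isCoefficientBound`; boundedness of `K`, `K'`
and their Lipschitz constants enter here). For `k` large, integrating the coefficients over time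
halves the distance of any two candidates that are driven by the same input, uniformly over inputs
(`Model.IsCoefficientBound.abs_integral_drift_sub_le`). Three facts follow.

* Two solutions with the same input differ by a bounded amount, because the noise cancels, and this
  bound can be halved for ever: pathwise uniqueness (`IsSolution.ae_eq`).
* For a given law `ν` of the input, the Picard map is a contraction of a space of bounded continuous
  functions of input and time. Its fixed point gives a solution map `F`
  (`Model.exists_isSolutionMap`).
* The path `F (x, w)` up to time `t` depends only on `w` up to time `t`, so that `F (X₀, W)` is a
  strong solution (`Model.IsSolutionMap.isStrongSolution`).

The law of `(X₀, W)` is the same for all inputs, since the finite-dimensional laws are built from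
independent Gaussian increments (`IsInput.map_eq`). By pathwise uniqueness every solution has the
law of `F (X₀, W)`, where `F` depends on that input law only; this is uniqueness in law.

For weak existence a Brownian motion has to be constructed: the isonormal Gaussian process of
`L²(ℝ)` is evaluated at indicators of intervals (`exists_isPreBrownianReal`), and Kolmogorov's
criterion with fourth moments gives a continuous version (`exists_continuous_version`). The same
argument shows that the supremum of the path has a finite fourth moment; as the law of the driving
path does not depend on the input, the second moment of every solution is finite.
-/

noncomputable section

namespace KilledMcKeanVlasov

/-! ### Bounds for the coefficients in an environment -/

theorem measurable_eval {T : ℝ} {E : Type*} [TopologicalSpace E] [MeasurableSpace E]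
    [BorelSpace E] (t : Icc (0 : ℝ) T) : Measurable fun w : PathSpace T E => w t :=
  (continuous_eval_const t).measurable

/-- Laws on path space under which the second component (the clock) never becomes negative. Such a
law gives `Φ` of each time marginal total mass at most `1`. -/
structure IsEnvironment {T : ℝ} (μ : Measure (PathSpace T (ℝ × ℝ))) : Prop where
  isProbabilityMeasure : IsProbabilityMeasure μ
  nonneg : ∀ᵐ w ∂μ, ∀ t, 0 ≤ (w t).2

theorem isClosed_nonneg_clock (T : ℝ) :
    IsClosed {w : PathSpace T (ℝ × ℝ) | ∀ t, 0 ≤ (w t).2} := by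
  simp only [ofPred_forall]
  exact isClosed_iInter fun t =>
    isClosed_le continuous_const (continuous_snd.comp (continuous_eval_const t))

theorem IsEnvironment.map {Ω : Type*} {mΩ : MeasurableSpace Ω} {P : Measure Ω}
    [IsProbabilityMeasure P] {T : ℝ} {Z : Ω → PathSpace T (ℝ × ℝ)} (hZ : Measurable Z)
    (h : ∀ᵐ ω ∂P, ∀ t, 0 ≤ (Z ω t).2) : IsEnvironment (P.map Z) :=
  ⟨Measure.isProbabilityMeasure_map hZ.aemeasurable,
    (ae_map_iff hZ.aemeasurable (isClosed_nonneg_clock T).measurableSet).2 h⟩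

/-- The laws `μ` and `μ'` admit a coupling under which the two paths stay within `δ e^{kt}` of each
other at every time `t`, i.e. their `∞`-Wasserstein distance for the weighted uniform norm is at
most `δ`. -/
def WithinDist {T : ℝ} (k δ : ℝ) (μ μ' : Measure (PathSpace T (ℝ × ℝ))) : Prop :=
  ∃ π : Measure (PathSpace T (ℝ × ℝ) × PathSpace T (ℝ × ℝ)),
    π.map Prod.fst = μ ∧ π.map Prod.snd = μ' ∧
      ∀ᵐ p ∂π, ∀ t : Icc (0 : ℝ) T, ‖p.1 t - p.2 t‖ ≤ δ * Real.exp (k * t)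

theorem WithinDist.map {Ω : Type*} {mΩ : MeasurableSpace Ω} {P : Measure Ω}
    {T k δ : ℝ} {Z Z' : Ω → PathSpace T (ℝ × ℝ)} (hZ : Measurable Z) (hZ' : Measurable Z')
    (h : ∀ᵐ ω ∂P, ∀ t : Icc (0 : ℝ) T, ‖Z ω t - Z' ω t‖ ≤ δ * Real.exp (k * t)) :
    WithinDist k δ (P.map Z) (P.map Z') := by
  refine ⟨P.map fun ω => (Z ω, Z' ω), ?_, ?_, ?_⟩
  · rw [Measure.map_map measurable_fst (hZ.prodMk hZ')]; rfl
  · rw [Measure.map_map measurable_snd (hZ.prodMk hZ')]; rfl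
  · refine (ae_map_iff (hZ.prodMk hZ').aemeasurable ?_).2 h
    apply IsClosed.measurableSet
    simp only [ofPred_forall]
    refine isClosed_iInter fun t => isClosed_le ?_ continuous_const
    exact (((continuous_eval_const t).comp continuous_fst).sub
      ((continuous_eval_const t).comp continuous_snd)).norm

/-- The field `f * Φ(μ_t)` as an integral over paths. -/
theorem conv_Phi_marginal {T : ℝ} (μ : Measure (PathSpace T (ℝ × ℝ))) {f : ℝ → ℝ}
    (hf : Continuous f) (t : Icc (0 : ℝ) T) (x : ℝ) :
    conv f (Phi (marginal μ t)) x = ∫ w, Real.exp (-(w t).2) * f (x - (w t).1) ∂μ := by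
  rw [conv, integral_Phi _ (fun y => f (x - y)) (by fun_prop), marginal,
    integral_map (measurable_eval t).aemeasurable]
  exact Continuous.aestronglyMeasurable (by fun_prop)

theorem exp_neg_mul_sub_le {f : ℝ → ℝ} {m : ℝ} {L : ℝ≥0} (hm : ∀ y, |f y| ≤ m)
    (hL : LipschitzWith L f) {a a' u u' : ℝ} (ha : 0 ≤ a) (ha' : 0 ≤ a') :
    |Real.exp (-a) * f u - Real.exp (-a') * f u'| ≤ m * |a - a'| + L * |u - u'| := by
  have h1 : |Real.exp (-a) - Real.exp (-a')| ≤ |a - a'| := by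
    wlog h : a ≤ a' generalizing a a'
    · rw [abs_sub_comm, abs_sub_comm a]; exact this ha' ha (le_of_not_ge h)
    have e1 : Real.exp (-a') ≤ Real.exp (-a) := Real.exp_le_exp.2 (by linarith)
    rw [abs_of_nonneg (by linarith), abs_of_nonpos (by linarith)]
    have e2 : Real.exp (-a') = Real.exp (-a) * Real.exp (a - a') := by
      rw [← Real.exp_add]; ring_nf
    have e3 := Real.add_one_le_exp (a - a')
    have e4 : Real.exp (-a) ≤ 1 := Real.exp_le_one_iff.2 (by linarith)
    have e5 := Real.exp_pos (-a)
    have e6 : Real.exp (a - a') ≤ 1 := Real.exp_le_one_iff.2 (by linarith)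
    rw [e2]
    nlinarith
  have h2 : |f u - f u'| ≤ L * |u - u'| := by simpa [Real.dist_eq] using hL.dist_le_mul u u'
  have h3 : Real.exp (-a') ≤ 1 := Real.exp_le_one_iff.2 (by linarith)
  have e : Real.exp (-a) * f u - Real.exp (-a') * f u'
      = f u * (Real.exp (-a) - Real.exp (-a')) + Real.exp (-a') * (f u - f u') := by ring
  rw [e]
  refine (abs_add_le _ _).trans (add_le_add ?_ ?_)
  · rw [abs_mul]; exact mul_le_mul (hm u) h1 (abs_nonneg _) ((abs_nonneg _).trans (hm u))
  · rw [abs_mul, abs_of_pos (Real.exp_pos _)]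
    exact (mul_le_of_le_one_left (abs_nonneg _) h3).trans h2

theorem abs_exp_neg_mul_le {f : ℝ → ℝ} {m : ℝ} (hm : ∀ y, |f y| ≤ m) {a : ℝ} (u : ℝ)
    (ha : 0 ≤ a) : |Real.exp (-a) * f u| ≤ m := by
  rw [abs_mul, abs_of_pos (Real.exp_pos _)]
  exact (mul_le_of_le_one_left (abs_nonneg _) (Real.exp_le_one_iff.2 (by linarith))).trans (hm u)

namespace IsEnvironment

variable {T : ℝ} {μ : Measure (PathSpace T (ℝ × ℝ))}

theorem abs_conv_le (hμ : IsEnvironment μ) {f : ℝ → ℝ} {m : ℝ} (hf : Continuous f)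
    (hm : ∀ y, |f y| ≤ m) (t : Icc (0 : ℝ) T) (x : ℝ) :
    |conv f (Phi (marginal μ t)) x| ≤ m := by
  have := hμ.isProbabilityMeasure
  rw [conv_Phi_marginal μ hf]
  have h := norm_integral_le_of_norm_le_const (μ := μ) (C := m)
    (f := fun w => Real.exp (-(w t).2) * f (x - (w t).1)) (by
      filter_upwards [hμ.nonneg] with w hw using abs_exp_neg_mul_le hm _ (hw t))
  simpa using h

theorem integrable (hμ : IsEnvironment μ) {f : ℝ → ℝ} {m : ℝ} (hf : Continuous f)
    (hm : ∀ y, |f y| ≤ m) (t : Icc (0 : ℝ) T) (x : ℝ) :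
    Integrable (fun w => Real.exp (-(w t).2) * f (x - (w t).1)) μ := by
  have := hμ.isProbabilityMeasure
  refine Integrable.of_bound (C := m) ?_ ?_
  · have h := (measurable_eval (E := ℝ × ℝ) t)
    exact Measurable.aestronglyMeasurable
      ((h.snd.neg.exp).mul (hf.measurable.comp (h.fst.const_sub x)))
  · filter_upwards [hμ.nonneg] with w hw using abs_exp_neg_mul_le hm _ (hw t)

/-- The convolution fields are Lipschitz in space, and depend on the environment in a Lipschitz way
for any coupling. -/
theorem abs_conv_sub_le {μ' : Measure (PathSpace T (ℝ × ℝ))} (hμ : IsEnvironment μ)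
    (hμ' : IsEnvironment μ') {f : ℝ → ℝ} {m : ℝ} {L : ℝ≥0} (hm : ∀ y, |f y| ≤ m)
    (hL : LipschitzWith L f) {k δ : ℝ} (h : WithinDist k δ μ μ') (t : Icc (0 : ℝ) T)
    (x x' : ℝ) :
    |conv f (Phi (marginal μ t)) x - conv f (Phi (marginal μ' t)) x'|
      ≤ (m + L) * (|x - x'| + δ * Real.exp (k * t)) := by
  obtain ⟨π, h1, h2, h3⟩ := h
  have hf := hL.continuous
  have hm0 : 0 ≤ m := (abs_nonneg _).trans (hm 0)
  have i1 := hμ.integrable hf hm t x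
  have i2 := hμ'.integrable hf hm t x'
  have n1 := hμ.nonneg
  have n2 := hμ'.nonneg
  have p1 := hμ.isProbabilityMeasure
  rw [conv_Phi_marginal μ hf, conv_Phi_marginal μ' hf]
  subst h1 h2
  have := Measure.isProbabilityMeasure_of_map (μ := π) Prod.fst
  have j1 := i1.comp_measurable measurable_fst
  have j2 := i2.comp_measurable measurable_snd
  simp only [Function.comp_def] at j1 j2
  rw [integral_map measurable_fst.aemeasurable i1.aestronglyMeasurable,
    integral_map measurable_snd.aemeasurable i2.aestronglyMeasurable, ← integral_sub j1 j2]
  have key := norm_integral_le_of_norm_le_const (μ := π)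
    (C := (m + L) * (|x - x'| + δ * Real.exp (k * t)))
    (f := fun p => Real.exp (-(p.1 t).2) * f (x - (p.1 t).1)
      - Real.exp (-(p.2 t).2) * f (x' - (p.2 t).1)) (by
      filter_upwards [h3, ae_of_ae_map measurable_fst.aemeasurable n1,
        ae_of_ae_map measurable_snd.aemeasurable n2] with p hp hp1 hp2
      rw [Real.norm_eq_abs]
      refine (exp_neg_mul_sub_le hm hL (hp1 t) (hp2 t)).trans ?_
      have e1 : |(p.1 t).1 - (p.2 t).1| ≤ δ * Real.exp (k * t) :=
        (norm_fst_le (p.1 t - p.2 t)).trans (hp t)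
      have e2 : |(p.1 t).2 - (p.2 t).2| ≤ δ * Real.exp (k * t) :=
        (norm_snd_le (p.1 t - p.2 t)).trans (hp t)
      have e3 : |x - (p.1 t).1 - (x' - (p.2 t).1)| ≤ |x - x'| + δ * Real.exp (k * t) := by
        have : x - (p.1 t).1 - (x' - (p.2 t).1) = (x - x') - ((p.1 t).1 - (p.2 t).1) := by ring
        rw [this]
        exact (abs_sub _ _).trans (by linarith)
      have e4 := mul_le_mul_of_nonneg_left e2 hm0
      have e5 := mul_le_mul_of_nonneg_left e3 L.coe_nonneg
      have e6 := mul_nonneg hm0 (abs_nonneg (x - x'))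
      linarith)
  simpa using key

end IsEnvironment

namespace Model

variable (M : Model)

theorem continuous_time : Continuous M.time := continuous_projIcc (h := M.T_pos.le)

theorem coe_time {r : ℝ} (hr : r ∈ Icc 0 M.T) : (M.time r : ℝ) = r := by
  rw [time, projIcc_of_mem _ hr]

variable {M} {μ μ' : Measure (PathSpace M.T (ℝ × ℝ))}

theorem continuous_conv (hμ : IsEnvironment μ) {f : ℝ → ℝ} {m : ℝ} (hf : Continuous f)
    (hm : ∀ y, |f y| ≤ m) {α : Type*} [TopologicalSpace α] [FirstCountableTopology α]
    {r x : α → ℝ} (hr : Continuous r) (hx : Continuous x) :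
    Continuous fun p => conv f (Phi (marginal μ (M.time (r p)))) (x p) := by
  have := hμ.isProbabilityMeasure
  simp only [conv_Phi_marginal μ hf]
  refine continuous_of_dominated (bound := fun _ => m) ?_ ?_ (integrable_const _) ?_
  · exact fun p => (hμ.integrable hf hm (M.time (r p)) (x p)).aestronglyMeasurable
  · intro p
    filter_upwards [hμ.nonneg] with w hw using abs_exp_neg_mul_le hm _ (hw _)
  · refine ae_of_all _ fun w => ?_
    have := M.continuous_time
    fun_prop

theorem continuous_timeConv (hμ : IsEnvironment μ) {f : ℝ → ℝ} {m : ℝ} (hf : Continuous f)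
    (hm : ∀ y, |f y| ≤ m) :
    Continuous fun p : ℝ × ℝ => M.timeConv f μ p.1 p.2 := by
  have h : Continuous (Function.uncurry fun (p : ℝ × ℝ) (r : ℝ) =>
      conv f (Phi (marginal μ (M.time r))) p.2) := by
    simp only [Function.uncurry_def]
    exact continuous_conv hμ hf hm (by fun_prop) (by fun_prop)
  unfold timeConv
  exact intervalIntegral.continuous_parametric_intervalIntegral_of_continuous h continuous_fst

theorem abs_timeConv_le (hμ : IsEnvironment μ) {f : ℝ → ℝ} {m : ℝ} (hf : Continuous f)
    (hm : ∀ y, |f y| ≤ m) {s : ℝ} (hs : s ∈ Icc 0 M.T) (x : ℝ) :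
    |M.timeConv f μ s x| ≤ M.T * m := by
  have hm0 : 0 ≤ m := (abs_nonneg _).trans (hm 0)
  have h := intervalIntegral.norm_integral_le_of_norm_le_const (a := 0) (b := s) (C := m)
    (f := fun r => conv f (Phi (marginal μ (M.time r))) x) fun r _ => hμ.abs_conv_le hf hm _ x
  refine h.trans ?_
  rw [sub_zero, abs_of_nonneg hs.1, mul_comm]
  exact mul_le_mul_of_nonneg_right hs.2 hm0

theorem timeConv_nonneg {f : ℝ → ℝ} (hf : ∀ y, 0 ≤ f y) {s : ℝ} (hs : 0 ≤ s) (x : ℝ) :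
    0 ≤ M.timeConv f μ s x :=
  intervalIntegral.integral_nonneg hs fun _ _ => integral_nonneg fun _ => hf _

theorem abs_timeConv_sub_le (hμ : IsEnvironment μ) (hμ' : IsEnvironment μ') {f : ℝ → ℝ}
    {m : ℝ} {L : ℝ≥0} (hm : ∀ y, |f y| ≤ m) (hL : LipschitzWith L f) {k δ : ℝ} (hk : 0 ≤ k)
    (hδ : 0 ≤ δ) (h : WithinDist k δ μ μ') {s : ℝ} (hs : s ∈ Icc 0 M.T) (x x' : ℝ) :
    |M.timeConv f μ s x - M.timeConv f μ' s x'|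
      ≤ M.T * (m + L) * (|x - x'| + δ * Real.exp (k * s)) := by
  have hf := hL.continuous
  have hm0 : 0 ≤ m := (abs_nonneg _).trans (hm 0)
  have c1 : Continuous fun r => conv f (Phi (marginal μ (M.time r))) x :=
    continuous_conv hμ hf hm continuous_id continuous_const
  have c2 : Continuous fun r => conv f (Phi (marginal μ' (M.time r))) x' :=
    continuous_conv hμ' hf hm continuous_id continuous_const
  rw [timeConv, timeConv, ← intervalIntegral.integral_sub (c1.intervalIntegrable _ _)
    (c2.intervalIntegrable _ _)]
  have key := intervalIntegral.norm_integral_le_of_norm_le_const (a := 0) (b := s)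
    (C := (m + L) * (|x - x'| + δ * Real.exp (k * s)))
    (f := fun r => conv f (Phi (marginal μ (M.time r))) x
      - conv f (Phi (marginal μ' (M.time r))) x') (fun r hr => by
      rw [uIoc_of_le hs.1] at hr
      refine (hμ.abs_conv_sub_le hμ' hm hL h _ x x').trans ?_
      rw [M.coe_time ⟨hr.1.le, hr.2.trans hs.2⟩]
      have := mul_le_mul_of_nonneg_left hr.2 hk
      gcongr)
  refine key.trans ?_
  rw [sub_zero, abs_of_nonneg hs.1, mul_comm, mul_assoc]
  exact mul_le_mul_of_nonneg_right hs.2 (by positivity)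

variable (M)

theorem exists_denominator_bound : ∃ d : ℝ, 0 < d ∧
    ∀ x, 0 ≤ x → d ≤ M.phi0 + M.phi1 * M.c0 * Real.exp (-M.lam * x) := by
  refine ⟨min M.phi0 (M.phi0 + M.phi1 * M.c0), lt_min M.phi0_pos M.denominator_pos,
    fun x hx => ?_⟩
  have e1 : Real.exp (-M.lam * x) ≤ 1 :=
    Real.exp_le_one_iff.2 (by nlinarith [M.lam_pos])
  have e0 := Real.exp_pos (-M.lam * x)
  rcases le_total 0 (M.phi1 * M.c0) with h | h
  · exact (min_le_left _ _).trans (by nlinarith)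
  · exact (min_le_right _ _).trans (by nlinarith)

/-- On the half plane `x ≥ 0`, the denominator in `b` is bounded below; hence `b` is bounded and
Lipschitz on strips. -/
theorem exists_b_bounds {Y : ℝ} (hY : 0 ≤ Y) : ∃ C B : ℝ, 0 ≤ C ∧ 0 ≤ B ∧
    (∀ x y, 0 ≤ x → |y| ≤ Y → |M.b x y| ≤ B) ∧
    ∀ x y x' y', 0 ≤ x → 0 ≤ x' → |y| ≤ Y → |y'| ≤ Y →
      |M.b x y - M.b x' y'| ≤ C * (|x - x'| + |y - y'|) := by
  obtain ⟨d, hd, hD⟩ := M.exists_denominator_bound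
  set A := |(-(M.phi1 * M.lam * M.c0))| with hA
  have hA0 : 0 ≤ A := abs_nonneg _
  have l0 := M.lam_pos
  have p0 := M.phi0_pos
  set g : ℝ → ℝ := fun x => Real.exp (-M.lam * x)
    / (M.phi0 + M.phi1 * M.c0 * Real.exp (-M.lam * x)) with hg
  have hb : ∀ x y, M.b x y = -(M.phi1 * M.lam * M.c0) * (g x * y) := by
    intro x y; simp only [b, hg]; ring
  have g1 : ∀ x, 0 ≤ x → |g x| ≤ 1 / d := by
    intro x hx
    have h := hD x hx
    rw [hg, abs_of_nonneg (div_nonneg (Real.exp_pos _).le (hd.le.trans h))]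
    exact div_le_div₀ zero_le_one (Real.exp_le_one_iff.2 (by nlinarith)) hd h
  have g2 : ∀ x x', 0 ≤ x → 0 ≤ x' → |g x - g x'| ≤ M.phi0 * M.lam / d ^ 2 * |x - x'| := by
    intro x x' hx hx'
    have h := hD x hx
    have h' := hD x' hx'
    have e : g x - g x' = M.phi0 * (Real.exp (-M.lam * x) - Real.exp (-M.lam * x')) /
        ((M.phi0 + M.phi1 * M.c0 * Real.exp (-M.lam * x)) *
          (M.phi0 + M.phi1 * M.c0 * Real.exp (-M.lam * x'))) := by
      simp only [hg]
      rw [div_sub_div _ _ (hd.trans_le h).ne' (hd.trans_le h').ne']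
      ring
    have e2 : |Real.exp (-M.lam * x) - Real.exp (-M.lam * x')| ≤ M.lam * |x - x'| := by
      have := exp_neg_mul_sub_le (f := fun _ => 1) (m := 1) (L := 0) (by simp)
        (LipschitzWith.const 1) (u := 0) (u' := 0) (mul_nonneg l0.le hx) (mul_nonneg l0.le hx')
      simp only [mul_one, NNReal.coe_zero, zero_mul, add_zero, one_mul, ← mul_sub, abs_mul,
        abs_of_pos l0] at this
      simpa [neg_mul] using this
    rw [e, abs_div, abs_mul, abs_of_pos p0, abs_of_pos (mul_pos (hd.trans_le h) (hd.trans_le h'))]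
    calc _ ≤ M.phi0 * (M.lam * |x - x'|) / (d ^ 2) := by
          apply div_le_div₀ (by positivity) (by gcongr) (by positivity)
          rw [sq]; exact mul_le_mul h h' hd.le (hd.le.trans h)
      _ = _ := by ring
  refine ⟨A * (M.phi0 * M.lam / d ^ 2 * Y + 1 / d), A * (1 / d * Y), by positivity,
    by positivity, fun x y hx hy => ?_, fun x y x' y' hx hx' hy hy' => ?_⟩
  · rw [hb, abs_mul, abs_mul]
    have := g1 x hx
    gcongr
  · rw [hb, hb, ← mul_sub, abs_mul, mul_assoc A]
    refine mul_le_mul_of_nonneg_left ?_ hA0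
    have e : g x * y - g x' * y' = (g x - g x') * y + g x' * (y - y') := by ring
    rw [e]
    refine (abs_add_le _ _).trans ?_
    rw [abs_mul, abs_mul]
    have h1 := mul_le_mul (g2 x x' hx hx') hy (abs_nonneg _) (by positivity)
    have h2 := mul_le_mul_of_nonneg_right (g1 x' hx') (abs_nonneg (y - y'))
    have h3 : 0 ≤ M.phi0 * M.lam / d ^ 2 * Y * |y - y'| := by positivity
    have h4 : 0 ≤ 1 / d * |x - x'| := by positivity
    linarith

theorem rate_nonneg (μ : Measure (PathSpace M.T (ℝ × ℝ))) (s x : ℝ) : 0 ≤ M.rate μ s x := by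
  have := M.c0_nonneg
  have := M.lam_pos
  rw [rate, c]; positivity

/-- `C` and `B` are constants for which drift and rate are bounded by `B`, and Lipschitz with
constant `C` jointly in the position and in the environment. -/
structure IsCoefficientBound (C B : ℝ) : Prop where
  C_nonneg : 0 ≤ C
  B_nonneg : 0 ≤ B
  abs_drift_le : ∀ μ : Measure (PathSpace M.T (ℝ × ℝ)), IsEnvironment μ →
    ∀ s ∈ Icc 0 M.T, ∀ x, |M.drift μ s x| ≤ B
  abs_rate_le : ∀ μ : Measure (PathSpace M.T (ℝ × ℝ)), IsEnvironment μ →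
    ∀ s ∈ Icc 0 M.T, ∀ x, |M.rate μ s x| ≤ B
  abs_drift_sub_le : ∀ μ μ' : Measure (PathSpace M.T (ℝ × ℝ)), IsEnvironment μ →
    IsEnvironment μ' → ∀ k δ : ℝ, 0 ≤ k → 0 ≤ δ → WithinDist k δ μ μ' →
    ∀ s ∈ Icc 0 M.T, ∀ x x', |M.drift μ s x - M.drift μ' s x'|
      ≤ C * (|x - x'| + δ * Real.exp (k * s))
  abs_rate_sub_le : ∀ μ μ' : Measure (PathSpace M.T (ℝ × ℝ)), IsEnvironment μ →
    IsEnvironment μ' → ∀ k δ : ℝ, 0 ≤ k → 0 ≤ δ → WithinDist k δ μ μ' →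
    ∀ s ∈ Icc 0 M.T, ∀ x x', |M.rate μ s x - M.rate μ' s x'|
      ≤ C * (|x - x'| + δ * Real.exp (k * s))

/-- The argument `x` of `b` and `c` stays nonnegative because `K ≥ 0`, and the argument `y` of `b`
stays in a bounded interval because `K'` is bounded; there `b` and `c` are bounded and Lipschitz. -/
theorem exists_isCoefficientBound : ∃ C B : ℝ, M.IsCoefficientBound C B := by
  obtain ⟨m, hm⟩ := M.mollifier.bounded
  obtain ⟨m', hm'⟩ := M.mollifier.deriv_bounded
  obtain ⟨L, hL⟩ := M.mollifier.lipschitz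
  obtain ⟨L', hL'⟩ := M.mollifier.deriv_lipschitz
  have hm0 : 0 ≤ m := (abs_nonneg _).trans (hm 0)
  have hm0' : 0 ≤ m' := (abs_nonneg _).trans (hm' 0)
  have T0 := M.T_pos
  have l0 := M.lam_pos
  have c0 := M.c0_nonneg
  obtain ⟨Cb, Bb, hCb, hBb, hb, hb'⟩ := M.exists_b_bounds (Y := M.T * m') (by positivity)
  have hc : ∀ x x', 0 ≤ x → 0 ≤ x' → |M.c x - M.c x'| ≤ M.lam * M.c0 * M.lam * |x - x'| := by
    intro x x' hx hx'
    have := exp_neg_mul_sub_le (f := fun _ => 1) (m := 1) (L := 0) (by simp)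
      (LipschitzWith.const 1) (u := 0) (u' := 0) (mul_nonneg l0.le hx) (mul_nonneg l0.le hx')
    simp only [mul_one, NNReal.coe_zero, zero_mul, add_zero, one_mul, ← mul_sub, abs_mul,
      abs_of_pos l0] at this
    rw [c, c, ← mul_sub, abs_mul, abs_of_nonneg (by positivity : 0 ≤ M.lam * M.c0),
      mul_assoc _ M.lam]
    simp only [neg_mul]
    gcongr
  have hnn : ∀ (μ : Measure (PathSpace M.T (ℝ × ℝ))) (s x : ℝ), s ∈ Icc 0 M.T →
      0 ≤ M.timeConv M.K μ s x := fun μ s x hs => timeConv_nonneg M.mollifier.nonneg hs.1 x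
  refine ⟨Cb * (M.T * (m + L) + M.T * (m' + L')) + M.lam * M.c0 * M.lam * (M.T * (m + L)),
    Bb + M.lam * M.c0, by positivity, by positivity, fun μ hμ s hs x => ?_,
    fun μ hμ s hs x => ?_, fun μ μ' hμ hμ' k δ hk hδ h s hs x x' => ?_,
    fun μ μ' hμ hμ' k δ hk hδ h s hs x x' => ?_⟩
  · have := hb _ _ (hnn μ s x hs) (abs_timeConv_le hμ hL'.continuous hm' hs x)
    exact this.trans (le_add_of_nonneg_right (by positivity))
  · rw [abs_of_nonneg (M.rate_nonneg μ s x), rate, c]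
    have : Real.exp (-M.lam * M.timeConv M.K μ s x) ≤ 1 :=
      Real.exp_le_one_iff.2 (by nlinarith [hnn μ s x hs])
    have := mul_le_of_le_one_right (by positivity : 0 ≤ M.lam * M.c0) this
    linarith
  · have h1 := abs_timeConv_sub_le hμ hμ' hm hL hk hδ h hs x x'
    have h2 := abs_timeConv_sub_le hμ hμ' hm' hL' hk hδ h hs x x'
    have h3 := hb' _ _ _ _ (hnn μ s x hs) (hnn μ' s x' hs)
      (abs_timeConv_le hμ hL'.continuous hm' hs x) (abs_timeConv_le hμ' hL'.continuous hm' hs x')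
    have h4 := mul_le_mul_of_nonneg_left (add_le_add h1 h2) hCb
    have h5 : 0 ≤ M.lam * M.c0 * M.lam * (M.T * (m + L)) * (|x - x'| + δ * Real.exp (k * s)) := by
      positivity
    rw [drift, drift]
    linarith
  · have h1 := abs_timeConv_sub_le hμ hμ' hm hL hk hδ h hs x x'
    have h3 := hc _ _ (hnn μ s x hs) (hnn μ' s x' hs)
    have h4 := mul_le_mul_of_nonneg_left h1 (by positivity : 0 ≤ M.lam * M.c0 * M.lam)
    have h5 : 0 ≤ Cb * (M.T * (m + L) + M.T * (m' + L')) * (|x - x'| + δ * Real.exp (k * s)) := by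
      positivity
    rw [rate, rate]
    linarith

variable {M}

/-- The drift, with time clamped to `[0,T]`, is jointly continuous. (Outside `[0,T]` the denominator
in `b` may vanish.) -/
theorem continuous_drift (hμ : IsEnvironment μ) {α : Type*} [TopologicalSpace α]
    {r x : α → ℝ} (hr : Continuous r) (hx : Continuous x) :
    Continuous fun p : α => M.drift μ (M.time (r p)) (x p) := by
  obtain ⟨m, hm⟩ := M.mollifier.bounded
  obtain ⟨m', hm'⟩ := M.mollifier.deriv_bounded
  obtain ⟨L, hL⟩ := M.mollifier.lipschitz
  obtain ⟨L', hL'⟩ := M.mollifier.deriv_lipschitz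
  have ht : Continuous fun p : α => ((M.time (r p) : ℝ), x p) := by
    have := M.continuous_time
    fun_prop
  have h1 := (continuous_timeConv hμ hL.continuous hm).comp ht
  have h2 := (continuous_timeConv hμ hL'.continuous hm').comp ht
  have h3 : ∀ p : α, M.phi0 + M.phi1 * M.c0 *
      Real.exp (-M.lam * M.timeConv M.K μ (M.time (r p)) (x p)) ≠ 0 := by
    intro p
    obtain ⟨d, hd, hD⟩ := M.exists_denominator_bound
    exact (hd.trans_le (hD _ (timeConv_nonneg M.mollifier.nonneg (M.time (r p)).2.1 (x p)))).ne'
  simp only [Function.comp_def] at h1 h2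
  unfold drift b
  fun_prop (disch := exact h3 _)

theorem continuous_rate (hμ : IsEnvironment μ) {α : Type*} [TopologicalSpace α]
    {r x : α → ℝ} (hr : Continuous r) (hx : Continuous x) :
    Continuous fun p : α => M.rate μ (M.time (r p)) (x p) := by
  obtain ⟨m, hm⟩ := M.mollifier.bounded
  obtain ⟨L, hL⟩ := M.mollifier.lipschitz
  have ht : Continuous fun p : α => ((M.time (r p) : ℝ), x p) := by
    have := M.continuous_time
    fun_prop
  have h1 := (continuous_timeConv hμ hL.continuous hm).comp ht
  simp only [Function.comp_def] at h1
  unfold rate c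
  fun_prop

end Model

/-! ### Pathwise uniqueness and the solution map -/

/-- The primitive of `e^{(4C+1)s}` gains the factor `1 / (4C + 1)`, which absorbs the Lipschitz
constant `2C`. -/
theorem abs_integral_sub_le_half {C δ t : ℝ} (hC : 0 ≤ C) (hδ : 0 ≤ δ) (ht : 0 ≤ t)
    {g g' : ℝ → ℝ} (hg : IntervalIntegrable g volume 0 t) (hg' : IntervalIntegrable g' volume 0 t)
    (h : ∀ s ∈ Icc 0 t, |g s - g' s| ≤ C * (2 * δ * Real.exp ((4 * C + 1) * s))) :
    |(∫ s in (0 : ℝ)..t, g s) - ∫ s in (0 : ℝ)..t, g' s|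
      ≤ δ / 2 * Real.exp ((4 * C + 1) * t) := by
  have hk : 0 < 4 * C + 1 := by positivity
  have key := intervalIntegral.norm_integral_le_of_norm_le (μ := volume) ht
    (f := fun s => g s - g' s) (g := fun s => C * (2 * δ * Real.exp ((4 * C + 1) * s)))
    (ae_of_all _ fun s hs => h s ⟨hs.1.le, hs.2⟩)
    (Continuous.intervalIntegrable (by fun_prop) _ _)
  rw [← intervalIntegral.integral_sub hg hg']
  refine key.trans ?_
  rw [intervalIntegral.integral_const_mul, intervalIntegral.integral_const_mul,
    intervalIntegral.integral_comp_mul_left (fun x => Real.exp x) hk.ne', integral_exp]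
  have e : C * (4 * C + 1)⁻¹ ≤ 1 / 4 := by
    rw [← div_eq_mul_inv, div_le_iff₀ hk]; linarith
  have e1 : 1 ≤ Real.exp ((4 * C + 1) * t) := Real.one_le_exp (by positivity)
  simp only [mul_zero, Real.exp_zero, smul_eq_mul]
  calc C * (2 * δ * ((4 * C + 1)⁻¹ * (Real.exp ((4 * C + 1) * t) - 1)))
      = (C * (4 * C + 1)⁻¹) * (2 * δ * (Real.exp ((4 * C + 1) * t) - 1)) := by ring
    _ ≤ 1 / 4 * (2 * δ * (Real.exp ((4 * C + 1) * t) - 1)) := by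
        refine mul_le_mul_of_nonneg_right e ?_
        have : 0 ≤ Real.exp ((4 * C + 1) * t) - 1 := by linarith
        positivity
    _ ≤ δ / 2 * Real.exp ((4 * C + 1) * t) := by nlinarith

namespace Model

variable {M : Model} {μ μ' : Measure (PathSpace M.T (ℝ × ℝ))}

/-- Clamping the time to `[0,T]` does not change integrals up to a time in `[0,T]`. -/
theorem integral_time_eq {E : Type*} [NormedAddCommGroup E] [NormedSpace ℝ E]
    (g : ℝ → ℝ → E) (t : Icc (0 : ℝ) M.T) :
    ∫ s in (0 : ℝ)..t, g (M.time s) s = ∫ s in (0 : ℝ)..t, g s s := by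
  refine intervalIntegral.integral_congr fun s hs => ?_
  rw [uIcc_of_le t.2.1] at hs
  simp only [M.coe_time ⟨hs.1, hs.2.trans t.2.2⟩]

theorem intervalIntegrable_drift (hμ : IsEnvironment μ) {x : ℝ → ℝ} (hx : Continuous x)
    (t : Icc (0 : ℝ) M.T) :
    IntervalIntegrable (fun s => M.drift μ s (x s)) volume 0 t := by
  have h := (continuous_drift hμ continuous_id hx).intervalIntegrable
    (μ := volume) 0 t
  refine h.congr fun s hs => ?_
  rw [uIoc_of_le t.2.1] at hs
  simp [M.coe_time ⟨hs.1.le, hs.2.trans t.2.2⟩]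

theorem intervalIntegrable_rate (hμ : IsEnvironment μ) {x : ℝ → ℝ} (hx : Continuous x)
    (t : Icc (0 : ℝ) M.T) :
    IntervalIntegrable (fun s => M.rate μ s (x s)) volume 0 t := by
  have h := (continuous_rate hμ continuous_id hx).intervalIntegrable
    (μ := volume) 0 t
  refine h.congr fun s hs => ?_
  rw [uIoc_of_le t.2.1] at hs
  simp [M.coe_time ⟨hs.1.le, hs.2.trans t.2.2⟩]

namespace IsCoefficientBound

variable {C B : ℝ}

/-- The weight `e^{kt}` with `k = 4C + 1` makes the integrated drift contract: closeness of the
positions and of the environments is improved by a factor `2`. -/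
theorem abs_integral_drift_sub_le (h : M.IsCoefficientBound C B) (hμ : IsEnvironment μ)
    (hμ' : IsEnvironment μ') {δ : ℝ} (hδ : 0 ≤ δ) (hd : WithinDist (4 * C + 1) δ μ μ')
    {x x' : ℝ → ℝ} (hx : Continuous x) (hx' : Continuous x') (t : Icc (0 : ℝ) M.T)
    (hxx : ∀ s ∈ Icc (0 : ℝ) t, |x s - x' s| ≤ δ * Real.exp ((4 * C + 1) * s)) :
    |(∫ s in (0 : ℝ)..t, M.drift μ s (x s)) - ∫ s in (0 : ℝ)..t, M.drift μ' s (x' s)|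
      ≤ δ / 2 * Real.exp ((4 * C + 1) * t) := by
  have hC := h.C_nonneg
  refine abs_integral_sub_le_half hC hδ t.2.1 (intervalIntegrable_drift hμ hx t)
    (intervalIntegrable_drift hμ' hx' t) fun s hs => ?_
  refine (h.abs_drift_sub_le μ μ' hμ hμ' _ δ (by positivity) hδ hd s
    ⟨hs.1, hs.2.trans t.2.2⟩ _ _).trans (mul_le_mul_of_nonneg_left ?_ hC)
  linarith [hxx s hs]

theorem abs_integral_rate_sub_le (h : M.IsCoefficientBound C B) (hμ : IsEnvironment μ)
    (hμ' : IsEnvironment μ') {δ : ℝ} (hδ : 0 ≤ δ) (hd : WithinDist (4 * C + 1) δ μ μ')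
    {x x' : ℝ → ℝ} (hx : Continuous x) (hx' : Continuous x') (t : Icc (0 : ℝ) M.T)
    (hxx : ∀ s ∈ Icc (0 : ℝ) t, |x s - x' s| ≤ δ * Real.exp ((4 * C + 1) * s)) :
    |(∫ s in (0 : ℝ)..t, M.rate μ s (x s)) - ∫ s in (0 : ℝ)..t, M.rate μ' s (x' s)|
      ≤ δ / 2 * Real.exp ((4 * C + 1) * t) := by
  have hC := h.C_nonneg
  refine abs_integral_sub_le_half hC hδ t.2.1 (intervalIntegrable_rate hμ hx t)
    (intervalIntegrable_rate hμ' hx' t) fun s hs => ?_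
  refine (h.abs_rate_sub_le μ μ' hμ hμ' _ δ (by positivity) hδ hd s
    ⟨hs.1, hs.2.trans t.2.2⟩ _ _).trans (mul_le_mul_of_nonneg_left ?_ hC)
  linarith [hxx s hs]

theorem abs_integral_drift_le (h : M.IsCoefficientBound C B) (hμ : IsEnvironment μ) (x : ℝ → ℝ)
    (t : Icc (0 : ℝ) M.T) : |∫ s in (0 : ℝ)..t, M.drift μ s (x s)| ≤ B * M.T := by
  refine (intervalIntegral.norm_integral_le_of_norm_le_const (a := 0) (b := t)
    (f := fun s => M.drift μ s (x s)) (C := B) fun s hs => ?_).trans ?_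
  · rw [uIoc_of_le t.2.1] at hs
    exact h.abs_drift_le μ hμ s ⟨hs.1.le, hs.2.trans t.2.2⟩ _
  · rw [sub_zero, abs_of_nonneg t.2.1]
    exact mul_le_mul_of_nonneg_left t.2.2 h.B_nonneg

theorem abs_integral_rate_le (h : M.IsCoefficientBound C B) (hμ : IsEnvironment μ) (x : ℝ → ℝ)
    (t : Icc (0 : ℝ) M.T) : |∫ s in (0 : ℝ)..t, M.rate μ s (x s)| ≤ B * M.T := by
  refine (intervalIntegral.norm_integral_le_of_norm_le_const (a := 0) (b := t)
    (f := fun s => M.rate μ s (x s)) (C := B) fun s hs => ?_).trans ?_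
  · rw [uIoc_of_le t.2.1] at hs
    exact h.abs_rate_le μ hμ s ⟨hs.1.le, hs.2.trans t.2.2⟩ _
  · rw [sub_zero, abs_of_nonneg t.2.1]
    exact mul_le_mul_of_nonneg_left t.2.2 h.B_nonneg

end IsCoefficientBound

theorem eq_zero_of_forall_abs_le_half {a D E : ℝ} (h : ∀ n : ℕ, |a| ≤ D / 2 ^ n * E) : a = 0 := by
  have h1 : Filter.Tendsto (fun n : ℕ => D / 2 ^ n * E) Filter.atTop (nhds 0) := by
    have := ((tendsto_pow_atTop_nhds_zero_of_lt_one (by norm_num : (0 : ℝ) ≤ 1 / 2)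
      (by norm_num)).const_mul D).mul_const E
    simpa [div_eq_mul_inv] using this
  exact abs_nonpos_iff.1 (ge_of_tendsto' h1 h)

end Model

section Uniqueness

variable {M : Model} {Ω : Type*} {mΩ : MeasurableSpace Ω} {P : Measure Ω}

/-- The rate is nonnegative in any environment, hence so is the clock of a solution. -/
theorem IsSolution.isEnvironment [IsProbabilityMeasure P] {𝓕 : Filtration (Icc (0 : ℝ) M.T) mΩ}
    {X₀ : Ω → ℝ} {W : Ω → PathSpace M.T ℝ} {Z : Ω → PathSpace M.T (ℝ × ℝ)}
    (h : IsSolution M P 𝓕 X₀ W Z) : IsEnvironment (P.map Z) := by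
  refine IsEnvironment.map h.measurable ?_
  filter_upwards [h.clock] with ω hω t
  rw [hω t]
  exact intervalIntegral.integral_nonneg t.2.1 fun s _ => M.rate_nonneg _ _ _

/-- Pathwise uniqueness: the difference of two solutions does not involve the noise, so it is
bounded uniformly in `ω`, and this bound can be halved indefinitely. -/
theorem IsSolution.ae_eq [IsProbabilityMeasure P] {𝓕 𝓖 : Filtration (Icc (0 : ℝ) M.T) mΩ}
    {X₀ : Ω → ℝ} {W : Ω → PathSpace M.T ℝ} {Z Z' : Ω → PathSpace M.T (ℝ × ℝ)}
    (hZ : IsSolution M P 𝓕 X₀ W Z) (hZ' : IsSolution M P 𝓖 X₀ W Z') :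
    ∀ᵐ ω ∂P, ∀ t, Z ω t = Z' ω t := by
  obtain ⟨C, B, hB⟩ := M.exists_isCoefficientBound
  have hC := hB.C_nonneg
  have hB0 := hB.B_nonneg
  have hT := M.T_pos
  have hμ := hZ.isEnvironment
  have hμ' := hZ'.isEnvironment
  have key : ∀ n : ℕ, ∀ᵐ ω ∂P, ∀ t : Icc (0 : ℝ) M.T,
      ‖Z ω t - Z' ω t‖ ≤ 2 * (B * M.T) / 2 ^ n * Real.exp ((4 * C + 1) * t) := by
    intro n
    induction n with
    | zero =>
      filter_upwards [hZ.position, hZ.clock, hZ'.position, hZ'.clock] with ω h1 h2 h3 h4 t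
      have e1 : 1 ≤ Real.exp ((4 * C + 1) * t) :=
        Real.one_le_exp (mul_nonneg (by positivity) t.2.1)
      have hBT : 0 ≤ B * M.T := by positivity
      have e2 : 2 * (B * M.T) / 2 ^ 0 ≤ 2 * (B * M.T) / 2 ^ 0 * Real.exp ((4 * C + 1) * t) :=
        le_mul_of_one_le_right (by positivity) e1
      refine le_trans ?_ e2
      rw [pow_zero, div_one, Prod.norm_def, Prod.fst_sub, Prod.snd_sub, h1 t, h2 t, h3 t, h4 t]
      refine max_le ?_ ?_
      · have a1 := hB.abs_integral_drift_le hμ (fun s => (Z ω (M.time s)).1) t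
        have a2 := hB.abs_integral_drift_le hμ' (fun s => (Z' ω (M.time s)).1) t
        rw [Real.norm_eq_abs, add_sub_add_right_eq_sub, add_sub_add_left_eq_sub]
        exact (abs_sub _ _).trans (by linarith)
      · have a1 := hB.abs_integral_rate_le hμ (fun s => (Z ω (M.time s)).1) t
        have a2 := hB.abs_integral_rate_le hμ' (fun s => (Z' ω (M.time s)).1) t
        exact (abs_sub _ _).trans (by linarith)
    | succ n ih =>
      have hd := WithinDist.map hZ.measurable hZ'.measurable ih
      have hδ : 0 ≤ 2 * (B * M.T) / 2 ^ n := by positivity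
      filter_upwards [hZ.position, hZ.clock, hZ'.position, hZ'.clock, ih] with ω h1 h2 h3 h4 h5 t
      have c1 : Continuous fun s => (Z ω (M.time s)).1 := by
        have := M.continuous_time; fun_prop
      have c2 : Continuous fun s => (Z' ω (M.time s)).1 := by
        have := M.continuous_time; fun_prop
      have hxx : ∀ s ∈ Icc (0 : ℝ) t, |(Z ω (M.time s)).1 - (Z' ω (M.time s)).1|
          ≤ 2 * (B * M.T) / 2 ^ n * Real.exp ((4 * C + 1) * s) := by
        intro s hs
        have := (norm_fst_le (Z ω (M.time s) - Z' ω (M.time s))).trans (h5 (M.time s))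
        rwa [M.coe_time ⟨hs.1, hs.2.trans t.2.2⟩] at this
      rw [pow_succ, ← div_div, Prod.norm_def, Prod.fst_sub, Prod.snd_sub, h1 t, h2 t, h3 t, h4 t]
      refine max_le ?_ (hB.abs_integral_rate_sub_le hμ hμ' hδ hd c1 c2 t hxx)
      rw [Real.norm_eq_abs, add_sub_add_right_eq_sub, add_sub_add_left_eq_sub]
      exact hB.abs_integral_drift_sub_le hμ hμ' hδ hd c1 c2 t hxx
  filter_upwards [ae_all_iff.2 key] with ω hω t
  refine sub_eq_zero.1 (norm_eq_zero.1 (Model.eq_zero_of_forall_abs_le_half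
    (D := 2 * (B * M.T)) (E := Real.exp ((4 * C + 1) * t)) fun n => ?_))
  rw [abs_of_nonneg (norm_nonneg _)]
  exact hω n t

end Uniqueness

namespace Model

variable (M : Model)

/-- The space of inputs: an initial value and a driving path. -/
abbrev Input : Type := ℝ × PathSpace M.T ℝ

/-- `F` maps an input to the solution of the integral equations in the environment generated by `F`
itself under the law `ν` of the input. -/
structure IsSolutionMap (ν : Measure M.Input) (F : C(M.Input, PathSpace M.T (ℝ × ℝ))) : Prop where
  position : ∀ p t, (F p t).1 = p.1 +
    (∫ s in (0 : ℝ)..t, M.drift (ν.map F) s (F p (M.time s)).1) + √2 * p.2 t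
  clock : ∀ p t, (F p t).2 = ∫ s in (0 : ℝ)..t, M.rate (ν.map F) s (F p (M.time s)).1

/-- The candidate solution whose drift part is `A`, weighted by `e^{-kt}`; the clock is made
nonnegative so that its law is an environment. -/
def candidate (k : ℝ) (A : BoundedContinuousFunction (M.Input × Icc (0 : ℝ) M.T) (ℝ × ℝ)) :
    C(M.Input, PathSpace M.T (ℝ × ℝ)) :=
  ContinuousMap.curry
    ⟨fun q => (q.1.1 + Real.exp (k * q.2) * (A q).1 + √2 * q.1.2 q.2,
      max (Real.exp (k * q.2) * (A q).2) 0), by fun_prop⟩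

variable {M}

theorem candidate_apply (k : ℝ)
    (A : BoundedContinuousFunction (M.Input × Icc (0 : ℝ) M.T) (ℝ × ℝ)) (p : M.Input)
    (t : Icc (0 : ℝ) M.T) :
    M.candidate k A p t = (p.1 + Real.exp (k * t) * (A (p, t)).1 + √2 * p.2 t,
      max (Real.exp (k * t) * (A (p, t)).2) 0) := rfl

theorem isEnvironment_candidate (ν : Measure M.Input) [IsProbabilityMeasure ν] (k : ℝ)
    (A : BoundedContinuousFunction (M.Input × Icc (0 : ℝ) M.T) (ℝ × ℝ)) :
    IsEnvironment (ν.map (M.candidate k A)) :=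
  IsEnvironment.map (M.candidate k A).continuous.measurable
    (ae_of_all _ fun p t => by rw [candidate_apply]; exact le_max_right _ _)

theorem norm_candidate_sub_le (k : ℝ)
    (A A' : BoundedContinuousFunction (M.Input × Icc (0 : ℝ) M.T) (ℝ × ℝ)) (p : M.Input)
    (t : Icc (0 : ℝ) M.T) :
    ‖M.candidate k A p t - M.candidate k A' p t‖ ≤ dist A A' * Real.exp (k * t) := by
  have h := A.dist_coe_le_dist (g := A') (p, t)
  rw [dist_eq_norm] at h
  have h1 := (norm_fst_le (A (p, t) - A' (p, t))).trans h
  have h2 := (norm_snd_le (A (p, t) - A' (p, t))).trans h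
  have h0 := Real.exp_pos (k * t)
  rw [Prod.fst_sub, Real.norm_eq_abs] at h1
  rw [Prod.snd_sub, Real.norm_eq_abs] at h2
  rw [candidate_apply, candidate_apply, Prod.mk_sub_mk, Prod.norm_def]
  refine max_le ?_ ?_
  · rw [Real.norm_eq_abs, add_sub_add_right_eq_sub, add_sub_add_left_eq_sub, ← mul_sub, abs_mul,
      abs_of_pos h0, mul_comm]
    exact mul_le_mul_of_nonneg_right h1 h0.le
  · rw [Real.norm_eq_abs]
    refine (abs_max_sub_max_le_abs _ _ _).trans ?_
    rw [← mul_sub, abs_mul, abs_of_pos h0, mul_comm]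
    exact mul_le_mul_of_nonneg_right h2 h0.le

/-- The integrated coefficients along the candidate built from `A`, weighted by `e^{-kt}`. Its fixed
points yield solution maps. -/
def picard (ν : Measure M.Input) (k : ℝ)
    (A : BoundedContinuousFunction (M.Input × Icc (0 : ℝ) M.T) (ℝ × ℝ))
    (q : M.Input × Icc (0 : ℝ) M.T) : ℝ × ℝ :=
  Real.exp (-(k * q.2)) •
    (∫ s in (0 : ℝ)..q.2, M.drift (ν.map (M.candidate k A)) s (M.candidate k A q.1 (M.time s)).1,
      ∫ s in (0 : ℝ)..q.2, M.rate (ν.map (M.candidate k A)) s (M.candidate k A q.1 (M.time s)).1)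

theorem continuous_candidate_fst (k : ℝ)
    (A : BoundedContinuousFunction (M.Input × Icc (0 : ℝ) M.T) (ℝ × ℝ)) {α : Type*}
    [TopologicalSpace α] {p : α → M.Input} {s : α → ℝ} (hp : Continuous p) (hs : Continuous s) :
    Continuous fun a => (M.candidate k A (p a) (M.time (s a))).1 := by
  have := M.continuous_time
  fun_prop

theorem continuous_picard (ν : Measure M.Input) [IsProbabilityMeasure ν] (k : ℝ)
    (A : BoundedContinuousFunction (M.Input × Icc (0 : ℝ) M.T) (ℝ × ℝ)) :
    Continuous (picard ν k A) := by
  have hμ := isEnvironment_candidate ν k A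
  have cx := continuous_candidate_fst k A (p := fun q : (M.Input × Icc (0 : ℝ) M.T) × ℝ => q.1.1)
    (s := fun q => q.2) (by fun_prop) (by fun_prop)
  have c1 : Continuous (Function.uncurry fun (q : M.Input × Icc (0 : ℝ) M.T) (s : ℝ) =>
      M.drift (ν.map (M.candidate k A)) (M.time s) (M.candidate k A q.1 (M.time s)).1) := by
    simp only [Function.uncurry_def]
    exact continuous_drift hμ (r := fun q : (M.Input × Icc (0 : ℝ) M.T) × ℝ => q.2)
      continuous_snd cx
  have c2 : Continuous (Function.uncurry fun (q : M.Input × Icc (0 : ℝ) M.T) (s : ℝ) =>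
      M.rate (ν.map (M.candidate k A)) (M.time s) (M.candidate k A q.1 (M.time s)).1) := by
    simp only [Function.uncurry_def]
    exact continuous_rate hμ (r := fun q : (M.Input × Icc (0 : ℝ) M.T) × ℝ => q.2)
      continuous_snd cx
  have ht : Continuous fun q : M.Input × Icc (0 : ℝ) M.T => (q.2 : ℝ) := by fun_prop
  have i1 := intervalIntegral.continuous_parametric_intervalIntegral_of_continuous (μ := volume)
    (a₀ := 0) c1 ht
  have i2 := intervalIntegral.continuous_parametric_intervalIntegral_of_continuous (μ := volume)
    (a₀ := 0) c2 ht
  have e1 := fun q : M.Input × Icc (0 : ℝ) M.T => integral_time_eq (fun a s =>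
    M.drift (ν.map (M.candidate k A)) a (M.candidate k A q.1 (M.time s)).1) q.2
  have e2 := fun q : M.Input × Icc (0 : ℝ) M.T => integral_time_eq (fun a s =>
    M.rate (ν.map (M.candidate k A)) a (M.candidate k A q.1 (M.time s)).1) q.2
  simp only [e1] at i1
  simp only [e2] at i2
  have h0 : Continuous fun q : M.Input × Icc (0 : ℝ) M.T => Real.exp (-(k * q.2)) := by fun_prop
  exact h0.smul (i1.prodMk i2)

theorem norm_picard_le (ν : Measure M.Input) [IsProbabilityMeasure ν] {C B k : ℝ}
    (hB : M.IsCoefficientBound C B) (hk : 0 ≤ k)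
    (A : BoundedContinuousFunction (M.Input × Icc (0 : ℝ) M.T) (ℝ × ℝ))
    (q : M.Input × Icc (0 : ℝ) M.T) : ‖picard ν k A q‖ ≤ B * M.T := by
  have hμ := isEnvironment_candidate ν k A
  rw [picard, norm_smul, Real.norm_eq_abs, abs_of_pos (Real.exp_pos _), Prod.norm_def]
  refine (mul_le_of_le_one_left (le_max_of_le_left (norm_nonneg _)) (Real.exp_le_one_iff.2
    (neg_nonpos.2 (mul_nonneg hk q.2.2.1)))).trans (max_le ?_ ?_)
  · exact hB.abs_integral_drift_le hμ _ q.2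
  · exact hB.abs_integral_rate_le hμ _ q.2

/-- The Picard map is a contraction for the weight `k = 4C + 1`. -/
theorem dist_picard_le (ν : Measure M.Input) [IsProbabilityMeasure ν] {C B : ℝ}
    (hB : M.IsCoefficientBound C B)
    (A A' : BoundedContinuousFunction (M.Input × Icc (0 : ℝ) M.T) (ℝ × ℝ))
    (q : M.Input × Icc (0 : ℝ) M.T) :
    dist (picard ν (4 * C + 1) A q) (picard ν (4 * C + 1) A' q) ≤ 1 / 2 * dist A A' := by
  set k := 4 * C + 1 with hk
  have hμ := isEnvironment_candidate ν k A
  have hμ' := isEnvironment_candidate ν k A'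
  have hd : WithinDist k (dist A A') (ν.map (M.candidate k A)) (ν.map (M.candidate k A')) :=
    WithinDist.map (M.candidate k A).continuous.measurable
      (M.candidate k A').continuous.measurable
      (ae_of_all _ fun p t => norm_candidate_sub_le k A A' p t)
  have hxx : ∀ s ∈ Icc (0 : ℝ) q.2, |(M.candidate k A q.1 (M.time s)).1
      - (M.candidate k A' q.1 (M.time s)).1| ≤ dist A A' * Real.exp (k * s) := by
    intro s hs
    have := (norm_fst_le _).trans (norm_candidate_sub_le k A A' q.1 (M.time s))
    rwa [M.coe_time ⟨hs.1, hs.2.trans q.2.2.2⟩] at this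
  have cx : ∀ A, Continuous fun s => (M.candidate k A q.1 (M.time s)).1 := fun A =>
    continuous_candidate_fst k A continuous_const continuous_id
  have h1 := hB.abs_integral_drift_sub_le hμ hμ' dist_nonneg hd (cx A) (cx A') q.2 hxx
  have h2 := hB.abs_integral_rate_sub_le hμ hμ' dist_nonneg hd (cx A) (cx A') q.2 hxx
  rw [picard, picard, dist_eq_norm, ← smul_sub, norm_smul, Real.norm_eq_abs,
    abs_of_pos (Real.exp_pos _), Prod.norm_def]
  refine (mul_le_mul_of_nonneg_left (max_le h1 h2) (Real.exp_pos _).le).trans (le_of_eq ?_)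
  rw [mul_left_comm, ← hk, ← Real.exp_add, neg_add_cancel, Real.exp_zero, mul_one,
    div_eq_inv_mul, one_div]

/-- The map `F` solving the McKean–Vlasov equation for the input law `ν` exists, as the fixed point
of a contraction of the space of bounded continuous functions. -/
theorem exists_isSolutionMap (ν : Measure M.Input) [IsProbabilityMeasure ν] :
    ∃ F, M.IsSolutionMap ν F := by
  obtain ⟨C, B, hB⟩ := M.exists_isCoefficientBound
  have hC := hB.C_nonneg
  have hk0 : 0 ≤ 4 * C + 1 := by positivity
  let Ψ : BoundedContinuousFunction (M.Input × Icc (0 : ℝ) M.T) (ℝ × ℝ) →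
      BoundedContinuousFunction (M.Input × Icc (0 : ℝ) M.T) (ℝ × ℝ) := fun A =>
    BoundedContinuousFunction.ofNormedAddCommGroup (picard ν (4 * C + 1) A)
      (continuous_picard ν _ A) (B * M.T) (norm_picard_le ν hB hk0 A)
  have hΨ : ContractingWith (1 / 2) Ψ := by
    refine ⟨by rw [← NNReal.coe_lt_coe]; norm_num, LipschitzWith.of_dist_le_mul fun A A' => ?_⟩
    rw [BoundedContinuousFunction.dist_le (by positivity)]
    intro q
    have h := dist_picard_le ν hB A A' q
    rw [one_div] at h
    rw [NNReal.coe_div, NNReal.coe_one, NNReal.coe_ofNat, one_div]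
    exact h
  have hfix := hΨ.fixedPoint_isFixedPt
  generalize ContractingWith.fixedPoint Ψ hΨ = A at hfix
  have hA : ∀ q, Real.exp ((4 * C + 1) * q.2) • A q =
      (∫ s in (0 : ℝ)..q.2, M.drift (ν.map (M.candidate (4 * C + 1) A)) s
        (M.candidate (4 * C + 1) A q.1 (M.time s)).1,
      ∫ s in (0 : ℝ)..q.2, M.rate (ν.map (M.candidate (4 * C + 1) A)) s
        (M.candidate (4 * C + 1) A q.1 (M.time s)).1) := by
    intro q
    have h1 : A q = picard ν (4 * C + 1) A q := (DFunLike.congr_fun hfix q).symm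
    rw [h1, picard, smul_smul, ← Real.exp_add, add_neg_cancel, Real.exp_zero, one_smul]
  refine ⟨M.candidate (4 * C + 1) A, fun p t => ?_, fun p t => ?_⟩
  · have h := congrArg Prod.fst (hA (p, t))
    simp only [Prod.smul_fst, smul_eq_mul] at h
    rw [← h, candidate_apply]
  · -- at the fixed point the truncation of the clock at `0` has no effect
    have h := congrArg Prod.snd (hA (p, t))
    simp only [Prod.smul_snd, smul_eq_mul] at h
    rw [← h, candidate_apply]
    refine max_eq_left ?_
    rw [h]
    exact intervalIntegral.integral_nonneg t.2.1 fun s _ => M.rate_nonneg _ _ _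

namespace IsSolutionMap

variable {ν : Measure M.Input} {F : C(M.Input, PathSpace M.T (ℝ × ℝ))}

theorem clock_nonneg (h : M.IsSolutionMap ν F) (p : M.Input) (t : Icc (0 : ℝ) M.T) :
    0 ≤ (F p t).2 := by
  rw [h.clock]
  exact intervalIntegral.integral_nonneg t.2.1 fun s _ => M.rate_nonneg _ _ _

theorem isEnvironment [IsProbabilityMeasure ν] (h : M.IsSolutionMap ν F) :
    IsEnvironment (ν.map F) :=
  IsEnvironment.map F.continuous.measurable (ae_of_all _ h.clock_nonneg)

/-- The solution up to time `t` depends on the driving path up to time `t` only. -/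
theorem nonanticipating [IsProbabilityMeasure ν] (h : M.IsSolutionMap ν F) {x : ℝ}
    {w w' : PathSpace M.T ℝ} {t : Icc (0 : ℝ) M.T} (hw : ∀ s ≤ t, w s = w' s) :
    F (x, w) t = F (x, w') t := by
  obtain ⟨C, B, hB⟩ := M.exists_isCoefficientBound
  have hC := hB.C_nonneg
  have hB0 := hB.B_nonneg
  have hT := M.T_pos
  have hμ := h.isEnvironment
  have c1 : ∀ w, Continuous fun s => (F (x, w) (M.time s)).1 := by
    intro w
    have := M.continuous_time
    fun_prop
  have key : ∀ n : ℕ, ∀ s ≤ t, |(F (x, w) s).1 - (F (x, w') s).1|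
      ≤ 2 * (B * M.T) / 2 ^ n * Real.exp ((4 * C + 1) * s) := by
    intro n
    induction n with
    | zero =>
      intro s hs
      have e1 : 1 ≤ Real.exp ((4 * C + 1) * s) :=
        Real.one_le_exp (mul_nonneg (by positivity) s.2.1)
      have a1 := hB.abs_integral_drift_le hμ (fun s => (F (x, w) (M.time s)).1) s
      have a2 := hB.abs_integral_drift_le hμ (fun s => (F (x, w') (M.time s)).1) s
      have hBT : 0 ≤ B * M.T := by positivity
      rw [h.position, h.position, hw s hs, add_sub_add_right_eq_sub, add_sub_add_left_eq_sub]
      refine (abs_sub _ _).trans ?_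
      rw [pow_zero, div_one]
      nlinarith
    | succ n ih =>
      intro s hs
      have hδ : 0 ≤ 2 * (B * M.T) / 2 ^ n := by positivity
      -- both paths live in the same environment, so any distance will do
      have hd : WithinDist (4 * C + 1) (2 * (B * M.T) / 2 ^ n) (ν.map F) (ν.map F) :=
        WithinDist.map F.continuous.measurable F.continuous.measurable
          (ae_of_all _ fun p r => by rw [sub_self, norm_zero]; positivity)
      rw [pow_succ, ← div_div, h.position, h.position, hw s hs, add_sub_add_right_eq_sub,
        add_sub_add_left_eq_sub]
      refine hB.abs_integral_drift_sub_le hμ hμ hδ hd (c1 w) (c1 w') s fun r hr => ?_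
      have hr' : r ∈ Icc 0 M.T := ⟨hr.1, hr.2.trans s.2.2⟩
      have := ih (M.time r) (by
        rw [← Subtype.coe_le_coe, M.coe_time hr']; exact hr.2.trans hs)
      rwa [M.coe_time hr'] at this
  have hX : ∀ s ≤ t, (F (x, w) s).1 = (F (x, w') s).1 := fun s hs =>
    sub_eq_zero.1 (eq_zero_of_forall_abs_le_half fun n => key n s hs)
  refine Prod.ext (hX t le_rfl) ?_
  rw [h.clock, h.clock]
  refine intervalIntegral.integral_congr fun r hr => ?_
  rw [uIcc_of_le t.2.1] at hr
  have hr' : r ∈ Icc 0 M.T := ⟨hr.1, hr.2.trans t.2.2⟩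
  rw [hX (M.time r) (by rw [← Subtype.coe_le_coe, M.coe_time hr']; exact hr.2)]

end IsSolutionMap

end Model

/-! ### The law of the input -/

/-- The Borel σ-algebra of path space is generated by the evaluations: the distance to a fixed path
is a supremum over countably many times. -/
theorem measurable_of_measurable_eval {T : ℝ} {α : Type*} {m : MeasurableSpace α}
    {f : α → PathSpace T ℝ} (h : ∀ t, Measurable fun a => f a t) : Measurable f := by
  have hd : ∀ g, Measurable fun a => dist (f a) g := by
    intro g
    refine measurable_of_Iic fun r => ?_
    rcases lt_or_ge r 0 with hr | hr
    · convert MeasurableSet.empty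
      ext a
      simpa using hr.trans_le dist_nonneg
    · obtain ⟨D, hD, hDd⟩ := TopologicalSpace.exists_countable_dense (Icc (0 : ℝ) T)
      have : (fun a => dist (f a) g) ⁻¹' Iic r = ⋂ t ∈ D, {a | dist (f a t) (g t) ≤ r} := by
        ext a
        simp only [mem_preimage, mem_Iic, ContinuousMap.dist_le hr, mem_iInter, mem_ofPred_eq]
        refine ⟨fun H t _ => H t, fun H t => ?_⟩
        exact (isClosed_le ((f a).continuous.dist g.continuous)
          continuous_const).closure_subset_iff.2 (fun t ht => H t ht) (hDd t)
      rw [this]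
      exact MeasurableSet.biInter hD fun t _ =>
        measurableSet_le ((h t).dist measurable_const) measurable_const
  refine measurable_of_isOpen fun U hU => ?_
  choose! ε hε hεU using Metric.isOpen_iff.1 hU
  obtain ⟨D, hDU, hD, hDe⟩ := TopologicalSpace.isOpen_biUnion_countable U
    (fun w => Metric.ball w (ε w)) fun _ _ => Metric.isOpen_ball
  have hUe : U = ⋃ w ∈ D, Metric.ball w (ε w) := by
    rw [hDe]
    refine Subset.antisymm (fun w hw => mem_biUnion hw (Metric.mem_ball_self (hε w hw))) ?_
    exact iUnion₂_subset fun w hw => hεU w hw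
  rw [hUe, preimage_iUnion₂]
  exact MeasurableSet.biUnion hD fun w _ => measurableSet_lt (hd w) measurable_const

/-- The coordinates of an input: its initial value and the values of the driving path. -/
def coordinates {T : ℝ} (p : ℝ × PathSpace T ℝ) : Option (Icc (0 : ℝ) T) → ℝ
  | none => p.1
  | some t => p.2 t

theorem measurable_coordinates {T : ℝ} : Measurable (coordinates (T := T)) := by
  refine measurable_pi_lambda _ fun o => ?_
  cases o with
  | none => exact measurable_fst
  | some t => exact (measurable_eval t).comp measurable_snd

/-- A law on the space of inputs is determined by its finite-dimensional marginals. -/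
theorem measure_ext_of_coordinates {T : ℝ} {μ ν : Measure (ℝ × PathSpace T ℝ)} [IsFiniteMeasure μ]
    (h : ∀ I : Finset (Option (Icc (0 : ℝ) T)), μ.map (fun p => I.restrict (coordinates p))
      = ν.map (fun p => I.restrict (coordinates p))) : μ = ν := by
  have h1 := isProjectiveLimit_map (P := μ) (X := fun o p => coordinates p o)
    measurable_coordinates.aemeasurable
  have h2 := isProjectiveLimit_map (P := ν) (X := fun o p => coordinates p o)
    measurable_coordinates.aemeasurable
  have h3 : μ.map coordinates = ν.map coordinates := by
    refine h1.unique fun I => ?_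
    exact (h2 I).trans (h I).symm
  have hid : Measurable[MeasurableSpace.comap coordinates inferInstance]
      (id : ℝ × PathSpace T ℝ → ℝ × PathSpace T ℝ) := by
    have hc := comap_measurable (m := inferInstance) (coordinates (T := T))
    refine @Measurable.prodMk _ _ _ _ _ (_) _ _ ?_ ?_
    · exact (measurable_pi_apply (none : Option (Icc (0 : ℝ) T))).comp hc
    · exact measurable_of_measurable_eval fun t =>
        (measurable_pi_apply (some t : Option (Icc (0 : ℝ) T))).comp hc
  ext A hA
  obtain ⟨B, hB, hBA⟩ := hid hA
  rw [preimage_id] at hBA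
  rw [← hBA, ← Measure.map_apply measurable_coordinates hB, h3,
    Measure.map_apply measurable_coordinates hB]

/-- Finitely many times can be enumerated increasingly, from time `0` on. -/
theorem exists_monotone_enumeration (M : Model) (I : Finset (Icc (0 : ℝ) M.T)) :
    ∃ τ : ℕ → Icc (0 : ℝ) M.T, Monotone τ ∧ τ 0 = M.zero ∧
      ∃ n, ∀ t ∈ I, ∃ i ≤ n, τ i = t := by
  classical
  set J := insert M.zero I
  obtain ⟨n, hn⟩ : ∃ n, J.card = n + 1 :=
    ⟨J.card - 1, (Nat.sub_add_cancel (Finset.card_pos.2 (Finset.insert_nonempty _ _))).symm⟩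
  refine ⟨fun i => J.orderEmbOfFin hn ⟨min i n, by omega⟩, fun i j hij => ?_, ?_, n,
    fun t ht => ?_⟩
  · exact (J.orderEmbOfFin hn).monotone (Fin.mk_le_mk.2 (min_le_min_right n hij))
  · have h0 := J.orderEmbOfFin_zero hn (Nat.succ_pos n)
    simp only [Nat.zero_min]
    rw [h0]
    refine le_antisymm (Finset.min'_le _ _ (Finset.mem_insert_self _ _)) ?_
    exact (J.min' _).2.1
  · have : t ∈ Set.range (J.orderEmbOfFin hn) := by
      rw [Finset.range_orderEmbOfFin]
      exact Finset.mem_insert_of_mem ht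
    obtain ⟨i, rfl⟩ := this
    refine ⟨i, Nat.lt_succ_iff.1 i.2, ?_⟩
    exact congrArg _ (Fin.ext (Nat.min_eq_left (Nat.lt_succ_iff.1 i.2)))

namespace IsInput

variable {M : Model} {ρ₀ : ℝ → ℝ} {Ω : Type*} {mΩ : MeasurableSpace Ω} {P : Measure Ω}
  {𝓕 : Filtration (Icc (0 : ℝ) M.T) mΩ} {X₀ : Ω → ℝ} {W : Ω → PathSpace M.T ℝ}

theorem measurable_initial (h : IsInput M P ρ₀ 𝓕 X₀ W) : Measurable X₀ :=
  h.initial_measurable.mono (𝓕.le _) le_rfl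

theorem measurable_driver (h : IsInput M P ρ₀ 𝓕 X₀ W) : Measurable W :=
  measurable_of_measurable_eval fun t => (h.brownian.adapted t).mono (𝓕.le t) le_rfl

theorem measurable_sampled (h : IsInput M P ρ₀ 𝓕 X₀ W) {τ : ℕ → Icc (0 : ℝ) M.T}
    (hτ : Monotone τ) (n : ℕ) :
    Measurable[𝓕 (τ n)] fun ω => (X₀ ω, fun i : ℕ => W ω (τ (min i n))) := by
  refine @Measurable.prodMk _ _ _ _ _ (_) _ _
    (h.initial_measurable.mono (𝓕.mono (τ n).2.1) le_rfl) ?_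
  exact @measurable_pi_lambda _ _ _ (_) _ _ fun i =>
    (h.brownian.adapted _).mono (𝓕.mono (hτ (min_le_right i n))) le_rfl

/-- The law of the initial value and of the samples at times `τ 0, …, τ (n+1)` is obtained from
that at times `τ 0, …, τ n` by adding an independent Gaussian increment. -/
theorem map_sampled_succ (h : IsInput M P ρ₀ 𝓕 X₀ W) {τ : ℕ → Icc (0 : ℝ) M.T}
    (hτ : Monotone τ) (n : ℕ) :
    P.map (fun ω => (X₀ ω, fun i : ℕ => W ω (τ (min i (n + 1))))) =
      ((P.map fun ω => (X₀ ω, fun i : ℕ => W ω (τ (min i n)))).prod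
        (gaussianReal 0 (Real.toNNReal ((τ (n + 1) : ℝ) - τ n)))).map
      (fun q => (q.1.1, fun i : ℕ => if i ≤ n then q.1.2 i else q.1.2 n + q.2)) := by
  have := h.isProbabilityMeasure
  have hV := h.measurable_sampled hτ n
  have hV' := hV.mono (𝓕.le _) le_rfl
  have hle := hτ (Nat.le_succ n)
  have hD := h.brownian.increments _ _ hle
  have hind : IndepFun (fun ω => (X₀ ω, fun i : ℕ => W ω (τ (min i n))))
      (fun ω => W ω (τ (n + 1)) - W ω (τ n)) P :=
    indep_of_indep_of_le_left (h.brownian.indep _ _ hle) hV.comap_le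
  have hmeas : Measurable fun q : (ℝ × (ℕ → ℝ)) × ℝ =>
      (q.1.1, fun i : ℕ => if i ≤ n then q.1.2 i else q.1.2 n + q.2) := by
    refine Measurable.prodMk (by fun_prop) (measurable_pi_lambda _ fun i => ?_)
    split_ifs <;> fun_prop
  have hprod := (indepFun_iff_map_prod_eq_prod_map_map hV'.aemeasurable hD.aemeasurable).1 hind
  rw [← hD.map_eq, ← hprod, AEMeasurable.map_map_of_aemeasurable hmeas.aemeasurable
    (hV'.aemeasurable.prodMk hD.aemeasurable)]
  congr 1
  ext ω
  · rfl
  · rename_i i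
    simp only [Function.comp_apply]
    split_ifs with hi
    · rw [min_eq_left hi, min_eq_left (hi.trans (Nat.le_succ n))]
    · rw [min_eq_right (by omega : n + 1 ≤ i), min_self]
      ring

/-- The law of the pair (initial value, driving path) is the same for all inputs. -/
theorem map_eq (h : IsInput M P ρ₀ 𝓕 X₀ W) {Ω' : Type*} {mΩ' : MeasurableSpace Ω'}
    {P' : Measure Ω'} {𝓕' : Filtration (Icc (0 : ℝ) M.T) mΩ'} {X₀' : Ω' → ℝ}
    {W' : Ω' → PathSpace M.T ℝ} (h' : IsInput M P' ρ₀ 𝓕' X₀' W') :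
    P.map (fun ω => (X₀ ω, W ω)) = P'.map fun ω => (X₀' ω, W' ω) := by
  have := h.isProbabilityMeasure
  have := h'.isProbabilityMeasure
  have m1 := h.measurable_initial.prodMk h.measurable_driver
  have m2 := h'.measurable_initial.prodMk h'.measurable_driver
  -- the laws of samples at increasing times agree, by induction over the number of times
  have key : ∀ τ : ℕ → Icc (0 : ℝ) M.T, Monotone τ → τ 0 = M.zero → ∀ n,
      P.map (fun ω => (X₀ ω, fun i : ℕ => W ω (τ (min i n)))) =
        P'.map (fun ω => (X₀' ω, fun i : ℕ => W' ω (τ (min i n)))) := by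
    intro τ hτ h0 n
    induction n with
    | zero =>
      have hm : Measurable fun x : ℝ => (x, fun _ : ℕ => (0 : ℝ)) := by fun_prop
      have e1 : P.map (fun ω => (X₀ ω, fun i : ℕ => W ω (τ (min i 0)))) =
          P.map (fun ω => (X₀ ω, fun _ : ℕ => (0 : ℝ))) := by
        refine Measure.map_congr ?_
        filter_upwards [h.brownian.zero] with ω hω
        simp only [Nat.min_zero, h0, hω]
      have e2 : P'.map (fun ω => (X₀' ω, fun i : ℕ => W' ω (τ (min i 0)))) =
          P'.map (fun ω => (X₀' ω, fun _ : ℕ => (0 : ℝ))) := by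
        refine Measure.map_congr ?_
        filter_upwards [h'.brownian.zero] with ω hω
        simp only [Nat.min_zero, h0, hω]
      rw [e1, e2]
      have f1 := Measure.map_map (μ := P) hm h.measurable_initial
      have f2 := Measure.map_map (μ := P') hm h'.measurable_initial
      simp only [Function.comp_def] at f1 f2
      rw [← f1, ← f2, h.initial_law.map_eq, h'.initial_law.map_eq]
    | succ n ih => rw [h.map_sampled_succ hτ, h'.map_sampled_succ hτ, ih]
  have := Measure.isProbabilityMeasure_map (μ := P) m1.aemeasurable
  refine measure_ext_of_coordinates fun I => ?_
  obtain ⟨τ, hτ, h0, n, hn⟩ := exists_monotone_enumeration M I.eraseNone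
  have hn' : ∀ t : Icc (0 : ℝ) M.T, ∃ i, some t ∈ I → i ≤ n ∧ τ i = t := by
    intro t
    by_cases ht : some t ∈ I
    · obtain ⟨i, hi, e⟩ := hn t (Finset.mem_eraseNone.2 ht)
      exact ⟨i, fun _ => ⟨hi, e⟩⟩
    · exact ⟨0, fun H => absurd H ht⟩
  choose idx hidx using hn'
  -- any finite family of coordinates is read off from the samples at increasing times
  have hread : Measurable fun (q : ℝ × (ℕ → ℝ)) (o : I) =>
      (o : Option (Icc (0 : ℝ) M.T)).elim q.1 fun t => q.2 (idx t) := by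
    refine measurable_pi_lambda _ fun o => ?_
    obtain ⟨o, ho⟩ := o
    cases o with
    | none => exact measurable_fst
    | some t => exact (measurable_pi_apply (idx t)).comp measurable_snd
  have hfac : ∀ (x : ℝ) (w : PathSpace M.T ℝ), I.restrict (coordinates (x, w)) =
      fun o : I => (o : Option (Icc (0 : ℝ) M.T)).elim x fun t => w (τ (min (idx t) n)) := by
    intro x w
    funext o
    obtain ⟨o, ho⟩ := o
    cases o with
    | none => rfl
    | some t =>
      have := hidx t ho
      simp only [Finset.restrict, coordinates, Option.elim_some, min_eq_left this.1, this.2]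
  have mI : Measurable fun p : ℝ × PathSpace M.T ℝ => I.restrict (coordinates p) :=
    (Finset.measurable_restrict I).comp measurable_coordinates
  have g1 := Measure.map_map (μ := P) hread ((h.measurable_sampled hτ n).mono (𝓕.le _) le_rfl)
  have g2 := Measure.map_map (μ := P') hread ((h'.measurable_sampled hτ n).mono (𝓕'.le _) le_rfl)
  rw [Measure.map_map mI m1, Measure.map_map mI m2]
  simp only [Function.comp_def, hfac] at g1 g2 ⊢
  rw [← g1, ← g2, key τ hτ h0 n]

end IsInput

/-! ### Strong solutions from the solution map -/

theorem IsInitialDensity.isProbabilityMeasure {ρ : ℝ → ℝ} (h : IsInitialDensity ρ) :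
    IsProbabilityMeasure (densityMeasure ρ) := by
  refine ⟨?_⟩
  rw [densityMeasure, withDensity_apply _ MeasurableSet.univ, Measure.restrict_univ,
    ← ofReal_integral_eq_lintegral_ofReal h.integrable (ae_of_all _ h.nonneg), h.integral_eq_one,
    ENNReal.ofReal_one]

theorem IsInitialDensity.memLp_id {ρ : ℝ → ℝ} (h : IsInitialDensity ρ) :
    MemLp id 2 (densityMeasure ρ) := by
  rw [memLp_two_iff_integrable_sq measurable_id.aestronglyMeasurable, densityMeasure,
    integrable_withDensity_iff h.continuous.measurable.ennreal_ofReal (by simp)]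
  simpa [ENNReal.toReal_ofReal (h.nonneg _)] using h.second_moment

theorem hasFiniteSecondMoment_map {Ω : Type*} {mΩ : MeasurableSpace Ω} {P : Measure Ω} {T : ℝ}
    {Z : Ω → PathSpace T (ℝ × ℝ)} (hZ : Measurable Z) (h : MemLp Z 2 P) :
    HasFiniteSecondMoment (P.map Z) := by
  have h1 := lintegral_rpow_enorm_lt_top_of_eLpNorm_lt_top two_ne_zero (by simp) h.eLpNorm_lt_top
  rw [HasFiniteSecondMoment, lintegral_map (by fun_prop) hZ]
  simpa using h1

/-- The path `w` stopped at time `t`. -/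
def stopAt {T : ℝ} (t : Icc (0 : ℝ) T) (w : PathSpace T ℝ) : PathSpace T ℝ :=
  w.comp ⟨fun s => min s t, by fun_prop⟩

theorem stopAt_apply {T : ℝ} (t s : Icc (0 : ℝ) T) (w : PathSpace T ℝ) :
    stopAt t w s = w (min s t) := rfl

namespace Model.IsSolutionMap

variable {M : Model} {ν : Measure M.Input} {F : C(M.Input, PathSpace M.T (ℝ × ℝ))}

/-- The drift part and the clock are bounded, so the solution grows linearly in the input. -/
theorem exists_norm_le [IsProbabilityMeasure ν] (h : M.IsSolutionMap ν F) :
    ∃ D : ℝ, ∀ x w, ‖F (x, w)‖ ≤ |x| + D + √2 * ‖w‖ := by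
  obtain ⟨C, B, hB⟩ := M.exists_isCoefficientBound
  have hBT : 0 ≤ B * M.T := mul_nonneg hB.B_nonneg M.T_pos.le
  have hμ := h.isEnvironment
  refine ⟨B * M.T, fun x w => ?_⟩
  have hw : 0 ≤ √2 * ‖w‖ := by positivity
  rw [ContinuousMap.norm_le _ (by positivity)]
  intro t
  rw [Prod.norm_def]
  refine max_le ?_ ?_
  · rw [h.position]
    have h1 := hB.abs_integral_drift_le hμ (fun s => (F (x, w) (M.time s)).1) t
    have h2 : |√2 * w t| ≤ √2 * ‖w‖ := by
      rw [abs_mul, abs_of_nonneg (Real.sqrt_nonneg 2)]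
      exact mul_le_mul_of_nonneg_left (w.norm_coe_le_norm t) (Real.sqrt_nonneg 2)
    exact (abs_add_three _ _ _).trans (by linarith)
  · rw [h.clock]
    have h1 := hB.abs_integral_rate_le hμ (fun s => (F (x, w) (M.time s)).1) t
    exact h1.trans (by linarith [abs_nonneg x])

/-- Evaluating the solution map along an input yields a strong solution. -/
theorem isStrongSolution {Ω : Type*} {mΩ : MeasurableSpace Ω} {P : Measure Ω}
    {𝓕 : Filtration (Icc (0 : ℝ) M.T) mΩ} {X₀ : Ω → ℝ} {W : Ω → PathSpace M.T ℝ} {ρ₀ : ℝ → ℝ}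
    (hρ₀ : IsInitialDensity ρ₀) (hin : IsInput M P ρ₀ 𝓕 X₀ W) (hW : MemLp W 2 P)
    (h : M.IsSolutionMap (P.map fun ω => (X₀ ω, W ω)) F) :
    IsStrongSolution M P 𝓕 X₀ W fun ω => F (X₀ ω, W ω) := by
  have := hin.isProbabilityMeasure
  have m1 := hin.measurable_initial.prodMk hin.measurable_driver
  have := Measure.isProbabilityMeasure_map (μ := P) m1.aemeasurable
  have mZ : Measurable fun ω => F (X₀ ω, W ω) := F.continuous.measurable.comp m1
  have hlaw : P.map (fun ω => F (X₀ ω, W ω)) = (P.map fun ω => (X₀ ω, W ω)).map F :=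
    (Measure.map_map F.continuous.measurable m1).symm
  have hσ : ∀ t, Measurable[inputSigma M X₀ W t] fun ω => F (X₀ ω, W ω) t := by
    intro t
    -- stopping the driving path at `t` does not affect the solution at time `t`
    have e : (fun ω => F (X₀ ω, W ω) t) = fun ω => F (X₀ ω, stopAt t (W ω)) t := by
      funext ω
      exact h.nonanticipating fun s hs => by rw [stopAt_apply, min_eq_left hs]
    rw [e]
    refine (measurable_eval t).comp (F.continuous.measurable.comp ?_)
    refine @Measurable.prodMk _ _ _ _ _ (_) _ _ ?_ ?_
    · exact (comap_measurable X₀).mono le_sup_left le_rfl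
    · refine measurable_of_measurable_eval fun s => ?_
      refine (comap_measurable fun ω => W ω (min s t)).mono ?_ le_rfl
      exact le_sup_of_le_right (le_iSup (fun s : Iic t =>
        MeasurableSpace.comap (fun ω => W ω s) inferInstance) ⟨min s t, min_le_right s t⟩)
  have hle : ∀ t, inputSigma M X₀ W t ≤ 𝓕 t := by
    intro t
    refine sup_le (hin.initial_measurable.comap_le.trans (𝓕.mono t.2.1)) (iSup_le fun s => ?_)
    exact (hin.brownian.adapted s).comap_le.trans (𝓕.mono s.2)
  refine ⟨⟨fun t => (hσ t).mono (hle t) le_rfl, mZ, hasFiniteSecondMoment_map mZ ?_, ?_, ?_⟩,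
    fun t => (hσ t).stronglyMeasurable.aestronglyMeasurable⟩
  · obtain ⟨D, hD⟩ := h.exists_norm_le
    have hX : MemLp X₀ 2 P := by
      have h1 := hρ₀.memLp_id
      rw [← hin.initial_law.map_eq] at h1
      exact h1.comp_of_map hin.initial_law.aemeasurable
    have hdom : MemLp (fun ω => |X₀ ω| + D + √2 * ‖W ω‖) 2 P :=
      (hX.abs.add (memLp_const D)).add (hW.norm.const_mul √2)
    refine hdom.mono mZ.aestronglyMeasurable (ae_of_all _ fun ω => ?_)
    exact (hD _ _).trans (le_abs_self _)
  · exact ae_of_all _ fun ω t => by rw [hlaw]; exact h.position _ t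
  · exact ae_of_all _ fun ω t => by rw [hlaw]; exact h.clock _ t

end Model.IsSolutionMap

/-- A solution is almost surely the solution map of the input law evaluated along the input. -/
theorem IsSolution.map_eq {M : Model} {Ω : Type*} {mΩ : MeasurableSpace Ω} {P : Measure Ω}
    {𝓕 : Filtration (Icc (0 : ℝ) M.T) mΩ} {X₀ : Ω → ℝ} {W : Ω → PathSpace M.T ℝ} {ρ₀ : ℝ → ℝ}
    (hρ₀ : IsInitialDensity ρ₀) (hin : IsInput M P ρ₀ 𝓕 X₀ W) (hW : MemLp W 2 P)
    {Z : Ω → PathSpace M.T (ℝ × ℝ)} (hZ : IsSolution M P 𝓕 X₀ W Z)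
    {F : C(M.Input, PathSpace M.T (ℝ × ℝ))}
    (hF : M.IsSolutionMap (P.map fun ω => (X₀ ω, W ω)) F) :
    P.map Z = (P.map fun ω => (X₀ ω, W ω)).map F := by
  have := hin.isProbabilityMeasure
  have m1 := hin.measurable_initial.prodMk hin.measurable_driver
  have h := hZ.ae_eq (hF.isStrongSolution hρ₀ hin hW).toIsSolution
  rw [Measure.map_map F.continuous.measurable m1]
  refine Measure.map_congr ?_
  filter_upwards [h] with ω hω using ContinuousMap.ext hω

/-! ### Existence of a pre-Brownian process -/

/-- Convergence in `L²` implies pointwise convergence of characteristic functions. -/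
theorem lipschitzWith_charFun_map {Ω : Type*} {mΩ : MeasurableSpace Ω} {P : Measure Ω}
    [IsProbabilityMeasure P] (s : ℝ) :
    LipschitzWith ‖s‖₊ fun f : Lp ℝ 2 P => charFun (P.map f) s := by
  intro f g
  have hm : ∀ f : Lp ℝ 2 P, AEMeasurable f P := fun f => (Lp.aestronglyMeasurable f).aemeasurable
  have hb : ∀ f : Lp ℝ 2 P, Integrable (fun ω => Complex.exp (s * f ω * Complex.I)) P := by
    intro h
    have hh := hm h
    refine Integrable.of_bound (C := 1) ?_ (ae_of_all _ fun ω => ?_)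
    · exact AEMeasurable.aestronglyMeasurable (by fun_prop)
    · rw [← Complex.ofReal_mul, Complex.norm_exp_ofReal_mul_I]
  have hpt : ∀ a b : ℝ, ‖Complex.exp (s * a * Complex.I) - Complex.exp (s * b * Complex.I)‖ₑ
      ≤ ‖s‖ₑ * ‖a - b‖ₑ := by
    intro a b
    have e : Complex.exp (s * a * Complex.I) - Complex.exp (s * b * Complex.I) =
        Complex.exp (((s * b : ℝ) : ℂ) * Complex.I) *
          (Complex.exp (Complex.I * ((s * (a - b) : ℝ) : ℂ)) - 1) := by
      rw [mul_sub, ← Complex.exp_add, mul_one]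
      push_cast
      ring_nf
    rw [e, ← enorm_mul, ← ofReal_norm, ← ofReal_norm]
    refine ENNReal.ofReal_le_ofReal ?_
    rw [norm_mul, Complex.norm_exp_ofReal_mul_I, one_mul]
    exact Real.norm_exp_I_mul_ofReal_sub_one_le
  simp only
  rw [charFun_apply_real, charFun_apply_real, integral_map (hm f) (by fun_prop),
    integral_map (hm g) (by fun_prop), edist_eq_enorm_sub, ← integral_sub (hb f) (hb g)]
  calc _ ≤ ∫⁻ ω, ‖Complex.exp (s * f ω * Complex.I) - Complex.exp (s * g ω * Complex.I)‖ₑ ∂P :=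
        enorm_integral_le_lintegral_enorm _
    _ ≤ ∫⁻ ω, ‖s‖ₑ * ‖(⇑f - ⇑g) ω‖ₑ ∂P := lintegral_mono fun ω => hpt _ _
    _ = ‖s‖ₑ * eLpNorm (⇑f - ⇑g) 1 P := by
        rw [lintegral_const_mul'' _ ((hm f).sub (hm g)).enorm, eLpNorm_one_eq_lintegral_enorm]
    _ ≤ ‖s‖ₑ * eLpNorm (⇑f - ⇑g) 2 P := by
        gcongr
        exact eLpNorm_le_eLpNorm_of_exponent_le (by norm_num)
          ((hm f).sub (hm g)).aestronglyMeasurable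
    _ = _ := by rw [Lp.edist_def]; rfl

/-- Isonormal Gaussian process: the vectors of a Hilbert space can be represented isometrically by
centred Gaussian random variables. A Hilbert basis is mapped to independent standard Gaussian
variables; finite linear combinations of these are Gaussian, and so are their `L²` limits. -/
theorem exists_isonormal (H : Type u) [NormedAddCommGroup H] [InnerProductSpace ℝ H]
    [CompleteSpace H] : ∃ (Ω : Type u) (_ : MeasurableSpace Ω) (P : Measure Ω)
      (_ : IsProbabilityMeasure P) (J : H →ₗᵢ[ℝ] Lp ℝ 2 P),
      ∀ h, HasLaw (J h) (gaussianReal 0 (‖h‖₊ ^ 2)) P := by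
  classical
  obtain ⟨ι, b, -⟩ := exists_hilbertBasis ℝ H
  let P : Measure (ι → ℝ) := Measure.infinitePi fun _ => gaussianReal 0 1
  have hind : iIndepFun (fun (i : ι) (ω : ι → ℝ) => ω i) P :=
    iIndepFun_infinitePi (X := fun _ x => x) fun _ => measurable_id
  have hmeas : ∀ i : ι, Measurable fun ω : ι → ℝ => ω i := measurable_pi_apply
  have hlaw : ∀ i : ι, HasLaw (fun ω : ι → ℝ => ω i) (gaussianReal 0 1) P := fun i =>
    ⟨(hmeas i).aemeasurable, Measure.infinitePi_map_eval _ i⟩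
  have hL : ∀ i : ι, MemLp (fun ω : ι → ℝ => ω i) 2 P := fun i => (hlaw i).hasGaussianLaw.memLp_two
  let v : ι → Lp ℝ 2 P := fun i => (hL i).toLp
  have hinner : ∀ i j, inner ℝ (v i) (v j) = ∫ ω, ω i * ω j ∂P := by
    intro i j
    rw [L2.inner_def]
    refine integral_congr_ae ?_
    filter_upwards [(hL i).coeFn_toLp, (hL j).coeFn_toLp] with ω h1 h2
    simp only [v, h1, h2, inner, star_trivial, RCLike.re_to_real]
    ring
  have hmean : ∀ i : ι, ∫ ω, ω i ∂P = 0 := fun i => by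
    rw [(hlaw i).integral_eq, integral_id_gaussianReal]
  have hv : Orthonormal ℝ v := by
    rw [orthonormal_iff_ite]
    intro i j
    rw [hinner]
    split_ifs with hij
    · subst hij
      have h1 := (hlaw i).variance_eq
      rw [variance_id_gaussianReal, variance_of_integral_eq_zero (hmeas i).aemeasurable
        (hmean i)] at h1
      simpa [sq] using h1
    · have := (hind.indepFun hij).integral_fun_mul_eq_mul_integral
        (hmeas i).aestronglyMeasurable (hmeas j).aestronglyMeasurable
      rw [this, hmean, zero_mul]
  have hO := hv.orthogonalFamily
  let J : H →ₗᵢ[ℝ] Lp ℝ 2 P := hO.linearIsometry.comp b.repr.toLinearIsometry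
  have hsum : ∀ (s : Finset ι) (c : ι → ℝ) (t : ℝ),
      charFun (P.map (∑ i ∈ s, c i • v i : Lp ℝ 2 P)) t =
        Complex.exp (-(((‖∑ i ∈ s, c i • v i‖ ^ 2 * t ^ 2 / 2 : ℝ)) : ℂ)) := by
    intro s c t
    have e1 : (∑ i ∈ s, c i • v i : Lp ℝ 2 P) =ᵐ[P] fun ω => ∑ i ∈ s, c i * ω i := by
      have h0 : (∑ i ∈ s, c i • v i : Lp ℝ 2 P) =ᵐ[P] ∑ i ∈ s, ⇑(c i • v i) := by
        induction s using Finset.induction_on with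
        | empty => simpa using Lp.coeFn_zero ℝ 2 P
        | insert i s hi ih =>
          rw [Finset.sum_insert hi, Finset.sum_insert hi]
          exact (Lp.coeFn_add _ _).trans (Filter.EventuallyEq.rfl.add ih)
      have h1 : ∀ᵐ ω ∂P, ∀ i ∈ s, (c i • v i : Lp ℝ 2 P) ω = c i * ω i := by
        refine (ae_ball_iff s.countable_toSet).2 fun i _ => ?_
        filter_upwards [Lp.coeFn_smul (c i) (v i), (hL i).coeFn_toLp] with ω h2 h3
        rw [h2, Pi.smul_apply, smul_eq_mul]
        simp only [v, h3]
      filter_upwards [h0, h1] with ω h2 h3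
      rw [h2, Finset.sum_apply]
      exact Finset.sum_congr rfl h3
    have e2 : ‖∑ i ∈ s, c i • v i‖ ^ 2 = ∑ i ∈ s, c i ^ 2 := by
      have := hO.norm_sum c s
      simpa using this
    have hind' : iIndepFun (s.restrict fun (i : ι) (ω : ι → ℝ) => c i * ω i) P :=
      (hind.comp (fun i x => c i * x) fun i => by fun_prop).restrict s
    rw [Measure.map_congr e1, hind'.charFun_map_fun_finsetSum_eq_prod (fun i _ =>
      ((hmeas i).const_mul (c i)).aemeasurable), e2,
      Finset.prod_apply, Finset.sum_mul, Finset.sum_div, Complex.ofReal_sum,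
      ← Finset.sum_neg_distrib, Complex.exp_sum]
    refine Finset.prod_congr rfl fun i _ => ?_
    rw [charFun_map_mul_comp (hmeas i).aemeasurable, (hlaw i).map_eq, charFun_gaussianReal]
    congr 1
    push_cast
    ring
  refine ⟨ι → ℝ, inferInstance, P, inferInstance, J, fun h => ?_⟩
  refine ⟨(Lp.aestronglyMeasurable _).aemeasurable, ?_⟩
  have := Measure.isProbabilityMeasure_map (μ := P)
    (Lp.aestronglyMeasurable (J h)).aemeasurable
  refine Measure.ext_of_charFun (funext fun t => ?_)
  have hs := hO.hasSum_linearIsometry (b.repr h)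
  simp only [LinearIsometry.toSpanSingleton_apply] at hs
  have l1 := ((lipschitzWith_charFun_map (P := P) t).continuous.tendsto _).comp hs
  have l2 : Filter.Tendsto (fun s : Finset ι =>
      Complex.exp (-(((‖∑ i ∈ s, b.repr h i • v i‖ ^ 2 * t ^ 2 / 2 : ℝ)) : ℂ))) Filter.atTop
      (nhds (Complex.exp (-(((‖J h‖ ^ 2 * t ^ 2 / 2 : ℝ)) : ℂ)))) := by
    have hc : Continuous fun f : Lp ℝ 2 P =>
      Complex.exp (-(((‖f‖ ^ 2 * t ^ 2 / 2 : ℝ)) : ℂ)) := by fun_prop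
    exact (hc.tendsto _).comp hs
  have l3 := tendsto_nhds_unique l1 (l2.congr fun s => (hsum s _ t).symm)
  refine Eq.trans l3 ?_
  rw [charFun_gaussianReal, J.norm_map]
  congr 1
  push_cast
  simp

/-- Brownian motion, without continuity of the paths, is the isonormal process of `L²(ℝ)` evaluated
at the indicators of the intervals `(0, t]`. -/
theorem exists_isPreBrownianReal : ∃ (Ω : Type) (_ : MeasurableSpace Ω) (P : Measure Ω)
    (X : ℝ≥0 → Ω → ℝ), IsProbabilityMeasure P ∧ IsPreBrownianReal X P := by
  obtain ⟨Ω, mΩ, P, hP, J, hJ⟩ := exists_isonormal (Lp ℝ 2 (volume : Measure ℝ))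
  let e : ℝ≥0 → Lp ℝ 2 (volume : Measure ℝ) := fun t =>
    indicatorConstLp 2 (measurableSet_Ioc (a := 0) (b := (t : ℝ))) (by simp) 1
  refine ⟨Ω, mΩ, P, fun t => J (e t), hP, ?_⟩
  have hmean : ∀ h, P[J h] = 0 := fun h => by
    rw [(hJ h).integral_eq, integral_id_gaussianReal]
  refine IsGaussianProcess.isPreBrownianReal_of_covariance ⟨fun I => ⟨?_⟩⟩ (fun t => hmean _) ?_
  · have hm : AEMeasurable (fun ω => I.restrict fun t => J (e t) ω) P :=
      aemeasurable_pi_lambda _ fun t => (hJ (e t)).aemeasurable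
    refine isGaussian_of_map_eq_gaussianReal fun L => ?_
    refine ⟨0, ‖∑ t : I, L (Pi.single t 1) • e t‖₊ ^ 2, ?_⟩
    rw [AEMeasurable.map_map_of_aemeasurable (by fun_prop) hm, ← (hJ _).map_eq]
    refine Measure.map_congr ?_
    have h0 : ∀ s : Finset I, (J (∑ t ∈ s, L (Pi.single t 1) • e t)) =ᵐ[P]
        fun ω => ∑ t ∈ s, L (Pi.single t 1) * J (e t) ω := by
      intro s
      induction s using Finset.induction_on with
      | empty =>
        simp only [Finset.sum_empty, map_zero]
        exact Lp.coeFn_zero ℝ 2 P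
      | insert i s hi ih =>
        rw [Finset.sum_insert hi, map_add, map_smul]
        filter_upwards [Lp.coeFn_add (L (Pi.single i 1) • J (e i))
          (J (∑ t ∈ s, L (Pi.single t 1) • e t)), Lp.coeFn_smul (L (Pi.single i 1)) (J (e i)),
          ih] with ω h1 h2 h3
        rw [h1, Pi.add_apply, h2, h3, Pi.smul_apply, smul_eq_mul, Finset.sum_insert hi]
    filter_upwards [h0 Finset.univ] with ω hω
    rw [hω, Function.comp_apply, ← ContinuousLinearMap.coe_coe, LinearMap.pi_apply_eq_sum_univ]
    refine Finset.sum_congr rfl fun t _ => ?_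
    rw [smul_eq_mul, mul_comm]
    congr 2
    ext j
    simp [Pi.single_apply, eq_comm]
  · intro s t hst
    have hE : inner ℝ (J (e s)) (J (e t)) = (s : ℝ) := by
      rw [J.inner_map_map, L2.real_inner_indicatorConstLp_one_indicatorConstLp_one _ _
          (by simp) (by simp),
        Ioc_inter_Ioc, max_self, min_eq_left (NNReal.coe_le_coe.2 hst)]
      simp
    rw [covariance_eq_sub (hJ _).hasGaussianLaw.memLp_two (hJ _).hasGaussianLaw.memLp_two, hmean,
      zero_mul, sub_zero, ← hE, L2.inner_def]
    refine integral_congr_ae (ae_of_all _ fun ω => ?_)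
    simp only [inner, star_trivial, RCLike.re_to_real, Pi.mul_apply]
    ring

/-! ### Kolmogorov's continuity criterion -/

/-- The piecewise linear interpolation of the values `a 0, …, a N` at the integers `0, …, N`, as a
sum of tent functions. -/
def interpolate (a : ℕ → ℝ) (N : ℕ) (u : ℝ) : ℝ :=
  ∑ k ∈ Finset.range (N + 1), a k * max 0 (1 - |u - k|)

theorem interpolate_eq (a : ℕ → ℝ) {N m : ℕ} (hm : m < N) {θ : ℝ} (h0 : 0 ≤ θ) (h1 : θ ≤ 1) :
    interpolate a N (m + θ) = (1 - θ) * a m + θ * a (m + 1) := by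
  rw [interpolate, Finset.sum_eq_add m (m + 1) (by omega)]
  · have e1 : |(m : ℝ) + θ - m| = θ := by rw [add_sub_cancel_left, abs_of_nonneg h0]
    have e2 : |(m : ℝ) + θ - (m + 1 : ℕ)| = 1 - θ := by
      push_cast
      rw [add_sub_add_left_eq_sub, abs_sub_comm, abs_of_nonneg (by linarith)]
    rw [e1, e2, max_eq_right (by linarith), max_eq_right (by linarith)]
    ring
  · rintro k - ⟨hk, hk'⟩
    rw [max_eq_left, mul_zero]
    rw [sub_nonpos, le_abs]
    rcases Nat.lt_or_gt_of_ne hk with h | h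
    · left
      have : (k : ℝ) + 1 ≤ m := by exact_mod_cast h
      linarith
    · right
      have : (m : ℝ) + 1 + 1 ≤ k := by exact_mod_cast (by omega : m + 1 + 1 ≤ k)
      linarith
  · intro h; exact absurd (Finset.mem_range.2 (by omega)) h
  · intro h; exact absurd (Finset.mem_range.2 (by omega)) h

theorem exists_nat_add {N : ℕ} (hN : 0 < N) {u : ℝ} (h0 : 0 ≤ u) (h1 : u ≤ N) :
    ∃ m : ℕ, m < N ∧ ∃ θ : ℝ, 0 ≤ θ ∧ θ ≤ 1 ∧ u = m + θ := by
  rcases h1.lt_or_eq with h | h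
  · refine ⟨⌊u⌋₊, (Nat.floor_lt h0).2 h, u - ⌊u⌋₊, sub_nonneg.2 (Nat.floor_le h0), ?_, by ring⟩
    linarith [Nat.lt_floor_add_one u]
  · refine ⟨N - 1, by omega, 1, zero_le_one, le_rfl, ?_⟩
    rw [h, Nat.cast_sub hN]
    simp

theorem pow_four_le_of_convex {p q x θ : ℝ} (h0 : 0 ≤ θ) (h1 : θ ≤ 1)
    (h : |x| ≤ (1 - θ) * |p| + θ * |q|) : x ^ 4 ≤ p ^ 4 + q ^ 4 := by
  have h2 : |x| ≤ max |p| |q| := by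
    have a1 := mul_le_mul_of_nonneg_left (le_max_left |p| |q|) (sub_nonneg.2 h1)
    have a2 := mul_le_mul_of_nonneg_left (le_max_right |p| |q|) h0
    linarith
  have e : ∀ y : ℝ, |y| ^ 4 = y ^ 4 := fun y => (by decide : Even 4).pow_abs y
  have h3 := pow_le_pow_left₀ (abs_nonneg x) h2 4
  rw [← e x, ← e p, ← e q]
  refine h3.trans ?_
  rcases max_choice |p| |q| with h | h <;> rw [h]
  · exact le_add_of_nonneg_right (by positivity)
  · exact le_add_of_nonneg_left (by positivity)

/-- Refining the grid changes the interpolation by no more than the largest increment on the finer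
grid. -/
theorem interpolate_refine (a : ℕ → ℝ) {N : ℕ} (hN : 0 < N) {u : ℝ} (h0 : 0 ≤ u) (h1 : u ≤ N) :
    (interpolate a (2 * N) (2 * u) - interpolate (fun k => a (2 * k)) N u) ^ 4
      ≤ ∑ j ∈ Finset.range (2 * N), (a (j + 1) - a j) ^ 4 := by
  obtain ⟨m, hm, θ, hθ0, hθ1, rfl⟩ := exists_nat_add hN h0 h1
  set p := a (2 * m + 1) - a (2 * m) with hp
  set q := a (2 * m + 2) - a (2 * m + 1) with hq
  have hsum : p ^ 4 + q ^ 4 ≤ ∑ j ∈ Finset.range (2 * N), (a (j + 1) - a j) ^ 4 := by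
    have hsub : ({2 * m, 2 * m + 1} : Finset ℕ) ⊆ Finset.range (2 * N) := by
      intro j hj
      simp only [Finset.mem_insert, Finset.mem_singleton] at hj
      exact Finset.mem_range.2 (by omega)
    refine le_trans (le_of_eq ?_) (Finset.sum_le_sum_of_subset_of_nonneg hsub
      fun j _ _ => by positivity)
    rw [Finset.sum_pair (by omega)]
  refine le_trans ?_ hsum
  have e0 : interpolate (fun k => a (2 * k)) N (m + θ) =
      (1 - θ) * a (2 * m) + θ * a (2 * m + 2) := interpolate_eq _ hm hθ0 hθ1
  have bound : ∀ s : ℝ, 0 ≤ s → s ≤ 1 / 2 → |s * (p - q)| ≤ (1 - 1 / 2) * |p| + 1 / 2 * |q| := by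
    intro s hs0 hs1
    rw [abs_mul, abs_of_nonneg hs0]
    have := mul_le_mul hs1 (abs_sub p q) (abs_nonneg _) (by norm_num)
    linarith
  refine pow_four_le_of_convex (θ := 1 / 2) (by norm_num) (by norm_num) ?_
  rcases le_total θ (1 / 2) with h | h
  · have e1 := interpolate_eq a (N := 2 * N) (m := 2 * m) (by omega) (θ := 2 * θ) (by linarith)
      (by linarith)
    have e2 : (2 : ℝ) * (m + θ) = (2 * m : ℕ) + 2 * θ := by push_cast; ring
    rw [e2, e1, e0]
    have : (1 - 2 * θ) * a (2 * m) + 2 * θ * a (2 * m + 1) -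
      ((1 - θ) * a (2 * m) + θ * a (2 * m + 2)) = θ * (p - q) := by rw [hp, hq]; ring
    rw [this]
    exact bound θ hθ0 h
  · have e1 := interpolate_eq a (N := 2 * N) (m := 2 * m + 1) (by omega) (θ := 2 * θ - 1)
      (by linarith) (by linarith)
    have e2 : (2 : ℝ) * (m + θ) = (2 * m + 1 : ℕ) + (2 * θ - 1) := by push_cast; ring
    rw [e2, e1, e0]
    have : (1 - (2 * θ - 1)) * a (2 * m + 1) + (2 * θ - 1) * a (2 * m + 1 + 1) -
      ((1 - θ) * a (2 * m) + θ * a (2 * m + 2)) = (1 - θ) * (p - q) := by rw [hp, hq]; ring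
    rw [this]
    exact bound (1 - θ) (by linarith) (by linarith)

/-- The continuous path which interpolates linearly between the values `a k` at the dyadic times
`k T / 2ⁿ`. -/
def dyadicPath (T : ℝ) (n : ℕ) (a : ℕ → ℝ) : PathSpace T ℝ :=
  ∑ k ∈ Finset.range (2 ^ n + 1),
    a k • (⟨fun t => max 0 (1 - |2 ^ n * (t / T) - k|), by fun_prop⟩ : PathSpace T ℝ)

theorem dyadicPath_apply (T : ℝ) (n : ℕ) (a : ℕ → ℝ) (t : Icc (0 : ℝ) T) :
    dyadicPath T n a t = interpolate a (2 ^ n) (2 ^ n * (t / T)) := by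
  simp [dyadicPath, interpolate]

theorem two_pow_mul_div_mem {T : ℝ} (hT : 0 < T) (n : ℕ) (t : Icc (0 : ℝ) T) :
    0 ≤ 2 ^ n * ((t : ℝ) / T) ∧ 2 ^ n * ((t : ℝ) / T) ≤ (2 ^ n : ℕ) := by
  have h1 : (t : ℝ) / T ≤ 1 := (div_le_one hT).2 t.2.2
  have h0 : 0 ≤ (t : ℝ) / T := div_nonneg t.2.1 hT.le
  push_cast
  exact ⟨by positivity, mul_le_of_le_one_right (by positivity) h1⟩

theorem sqrt_sqrt_pow_four {S : ℝ} (hS : 0 ≤ S) : √√S ^ 4 = S := by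
  rw [(by norm_num : 4 = 2 * 2), pow_mul, Real.sq_sqrt (Real.sqrt_nonneg _), Real.sq_sqrt hS]

/-- The maximum of the fourth powers of the increments on the finer grid is replaced by their sum,
whose expectation is easy to estimate. -/
theorem norm_dyadicPath_refine {T : ℝ} (hT : 0 < T) (n : ℕ) (a : ℕ → ℝ) :
    ‖dyadicPath T (n + 1) a - dyadicPath T n (fun k => a (2 * k))‖ ^ 4
      ≤ ∑ j ∈ Finset.range (2 ^ (n + 1)), (a (j + 1) - a j) ^ 4 := by
  set S := ∑ j ∈ Finset.range (2 ^ (n + 1)), (a (j + 1) - a j) ^ 4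
  have hS : 0 ≤ S := Finset.sum_nonneg fun j _ => by positivity
  have hD := sqrt_sqrt_pow_four hS
  rw [← hD]
  refine pow_le_pow_left₀ (norm_nonneg _) ?_ 4
  rw [ContinuousMap.norm_le _ (Real.sqrt_nonneg _)]
  intro t
  obtain ⟨h0, h1⟩ := two_pow_mul_div_mem hT n t
  have h := interpolate_refine a (N := 2 ^ n) (by positivity) h0 h1
  rw [← pow_le_pow_iff_left₀ (norm_nonneg _) (Real.sqrt_nonneg _) four_ne_zero, hD,
    Real.norm_eq_abs, (by decide : Even 4).pow_abs, ContinuousMap.sub_apply,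
    dyadicPath_apply, dyadicPath_apply]
  have e : (2 : ℝ) ^ (n + 1) * (t / T) = 2 * (2 ^ n * (t / T)) := by ring
  rw [← pow_succ'] at h
  rw [e]
  exact h

/-- At time `t` the interpolation is a convex combination of the values at the two neighbouring grid
times, which are within `T / 2ⁿ` of `t` and do not depend on the values. -/
theorem dyadicPath_sub_le {T : ℝ} (hT : 0 < T) (n : ℕ) (t : Icc (0 : ℝ) T) :
    ∃ k : ℕ, |k * T / 2 ^ n - t| ≤ T / 2 ^ n ∧ |(k + 1 : ℕ) * T / 2 ^ n - t| ≤ T / 2 ^ n ∧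
      ∀ (a : ℕ → ℝ) (x : ℝ), (dyadicPath T n a t - x) ^ 4 ≤ (a k - x) ^ 4 + (a (k + 1) - x) ^ 4 := by
  obtain ⟨h0, h1⟩ := two_pow_mul_div_mem hT n t
  obtain ⟨m, hm, θ, hθ0, hθ1, hu⟩ := exists_nat_add (by positivity) h0 h1
  have h2 : (0 : ℝ) < 2 ^ n := by positivity
  have ht : (t : ℝ) = (m + θ) * T / 2 ^ n := by
    rw [← hu]; field_simp
  refine ⟨m, ?_, ?_, fun a x => ?_⟩
  · rw [ht, ← sub_div, abs_div, abs_of_pos h2]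
    gcongr
    rw [← sub_mul, abs_mul, abs_of_pos hT, sub_add_cancel_left, abs_neg, abs_of_nonneg hθ0]
    exact mul_le_of_le_one_left hT.le hθ1
  · rw [ht, ← sub_div, abs_div, abs_of_pos h2]
    gcongr
    push_cast
    rw [← sub_mul, abs_mul, abs_of_pos hT, add_sub_add_left_eq_sub, abs_of_nonneg (by linarith)]
    exact mul_le_of_le_one_left hT.le (by linarith)
  · refine pow_four_le_of_convex hθ0 hθ1 ?_
    rw [dyadicPath_apply, hu, interpolate_eq a hm hθ0 hθ1]
    have : (1 - θ) * a m + θ * a (m + 1) - x = (1 - θ) * (a m - x) + θ * (a (m + 1) - x) := by ring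
    rw [this]
    refine (abs_add_le _ _).trans ?_
    rw [abs_mul, abs_mul, abs_of_nonneg hθ0, abs_of_nonneg (by linarith : 0 ≤ 1 - θ)]

section ContinuousVersion

variable {Ω : Type*} {mΩ : MeasurableSpace Ω} {P : Measure Ω}

theorem eLpNorm_four_le_ofReal {E : Type*} [NormedAddCommGroup E] {f : Ω → E} {D : ℝ} (hD : 0 ≤ D)
    (h : ∫⁻ ω, ENNReal.ofReal (‖f ω‖ ^ 4) ∂P ≤ ENNReal.ofReal (D ^ 4)) :
    eLpNorm f 4 P ≤ ENNReal.ofReal D := by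
  have h4 := eLpNorm_nnreal_pow_eq_lintegral (μ := P) (f := f) (p := 4) (by norm_num)
  have hp : ∀ x : ℝ≥0∞, x ^ ((4 : ℝ≥0) : ℝ) = x ^ 4 := fun x => by
    rw [← ENNReal.rpow_natCast]
    norm_num
  simp only [hp] at h4
  have h5 : ∫⁻ ω, ‖f ω‖ₑ ^ 4 ∂P = ∫⁻ ω, ENNReal.ofReal (‖f ω‖ ^ 4) ∂P := by
    refine lintegral_congr fun ω => ?_
    rw [ENNReal.ofReal_pow (norm_nonneg _), ofReal_norm]
  have h6 : eLpNorm f 4 P ^ 4 ≤ ENNReal.ofReal D ^ 4 := by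
    rw [← ENNReal.ofReal_pow hD]
    exact h4.le.trans (h5.le.trans h)
  exact (ENNReal.pow_le_pow_left_iff four_ne_zero).1 h6

/-- Kolmogorov's continuity criterion with fourth moments: the dyadic interpolations of the process
form a Cauchy sequence in `L⁴(Ω; C[0,T])`, and their limit is a version with continuous paths, whose
supremum has a finite fourth moment. -/
theorem exists_continuous_version {X : ℝ → Ω → ℝ} {C : ℝ} (hC : 0 ≤ C)
    (hX : ∀ t, MemLp (X t) 4 P)
    (hinc : ∀ s t, ∫⁻ ω, ENNReal.ofReal ((X s ω - X t ω) ^ 4) ∂P ≤ ENNReal.ofReal (C * (s - t) ^ 2))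
    {T : ℝ} (hT : 0 < T) :
    ∃ W : Ω → PathSpace T ℝ, Measurable W ∧ MemLp W 4 P ∧
      ∀ t : Icc (0 : ℝ) T, (fun ω => W ω t) =ᵐ[P] X t := by
  have : Fact ((1 : ℝ≥0∞) ≤ 4) := ⟨by norm_num⟩
  have hXm : ∀ t, AEMeasurable (X t) P := fun t => (hX t).aestronglyMeasurable.aemeasurable
  let Y : ℕ → Ω → PathSpace T ℝ := fun n ω => dyadicPath T n fun k => X (k * T / 2 ^ n) ω
  have hY : ∀ n, MemLp (Y n) 4 P := by
    intro n
    have h := memLp_finsetSum (p := 4) (μ := P) (Finset.range (2 ^ n + 1)) (f := fun k ω =>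
      X (k * T / 2 ^ n) ω •
        (⟨fun t => max 0 (1 - |2 ^ n * (t / T) - k|), by fun_prop⟩ : PathSpace T ℝ)) fun k _ =>
        ((ContinuousLinearMap.id ℝ ℝ).smulRight _).comp_memLp' (hX _)
    exact h
  -- the interpolations at the levels `n` and `n + 1` differ by at most an increment of step
  -- `T / 2 ^ (n + 1)`, and the sum of the fourth moments of these increments is geometric
  have hstep : ∀ n, eLpNorm (Y (n + 1) - Y n) 4 P
      ≤ ENNReal.ofReal (√√(C * T ^ 2) * √√(1 / 2) * √√(1 / 2) ^ n) := by
    intro n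
    refine eLpNorm_four_le_ofReal (by positivity) ?_
    have hD : (√√(C * T ^ 2) * √√(1 / 2) * √√(1 / 2) ^ n) ^ 4 =
        ∑ j ∈ Finset.range (2 ^ (n + 1)), C * (T / 2 ^ (n + 1)) ^ 2 := by
      rw [mul_pow, mul_pow, ← pow_mul, mul_comm n, pow_mul, sqrt_sqrt_pow_four (by positivity),
        sqrt_sqrt_pow_four (by norm_num), Finset.sum_const, Finset.card_range, nsmul_eq_mul,
        one_div_pow]
      push_cast
      field_simp
      ring
    rw [hD, ENNReal.ofReal_sum_of_nonneg fun j _ => by positivity]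
    calc _ ≤ ∫⁻ ω, ∑ j ∈ Finset.range (2 ^ (n + 1)), ENNReal.ofReal
            ((X ((j + 1 : ℕ) * T / 2 ^ (n + 1)) ω - X (j * T / 2 ^ (n + 1)) ω) ^ 4) ∂P := by
          refine lintegral_mono fun ω => ?_
          rw [← ENNReal.ofReal_sum_of_nonneg fun j _ => by positivity]
          refine ENNReal.ofReal_le_ofReal ?_
          have h := norm_dyadicPath_refine hT n fun k => X (k * T / 2 ^ (n + 1)) ω
          have e : (fun k : ℕ => X ((2 * k : ℕ) * T / 2 ^ (n + 1)) ω) =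
              fun k : ℕ => X (k * T / 2 ^ n) ω := by
            funext k
            congr 1
            push_cast
            field_simp
            ring
          rw [e] at h
          exact h
      _ = ∑ j ∈ Finset.range (2 ^ (n + 1)), ∫⁻ ω, ENNReal.ofReal
            ((X ((j + 1 : ℕ) * T / 2 ^ (n + 1)) ω - X (j * T / 2 ^ (n + 1)) ω) ^ 4) ∂P :=
          lintegral_finsetSum' _ fun j _ =>
            (((hXm _).sub (hXm _)).pow_const 4).ennreal_ofReal
      _ ≤ _ := by
          refine Finset.sum_le_sum fun j _ => (hinc _ _).trans (le_of_eq ?_)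
          congr 3
          push_cast
          ring
  have hcau : CauchySeq fun n => (hY n).toLp (Y n) := by
    refine cauchySeq_of_le_geometric √√(1 / 2) (√√(C * T ^ 2) * √√(1 / 2)) ?_ fun n => ?_
    · rw [Real.sqrt_lt' one_pos, Real.sqrt_lt' (by norm_num)]
      norm_num
    · rw [dist_comm, dist_eq_norm, ← MemLp.toLp_sub, Lp.norm_toLp]
      exact ENNReal.toReal_le_of_le_ofReal (by positivity) (hstep n)
  obtain ⟨V, hV⟩ := cauchySeq_tendsto_of_complete hcau
  have hWm : StronglyMeasurable V := Lp.stronglyMeasurable V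
  refine ⟨V, hWm.measurable, Lp.memLp V, fun t => ?_⟩
  have hVt : AEStronglyMeasurable (fun ω => V ω t) P :=
    ((measurable_eval t).comp hWm.measurable).aestronglyMeasurable
  have hYt : ∀ n, AEStronglyMeasurable (fun ω => Y n ω t) P := fun n =>
    ((measurable_eval t).comp_aemeasurable
      (hY n).aestronglyMeasurable.aemeasurable).aestronglyMeasurable
  have l1 : Filter.Tendsto (fun n => eLpNorm ((fun ω => Y n ω t) - fun ω => V ω t) 4 P)
      Filter.atTop (nhds 0) := by
    have h := (Lp.tendsto_Lp_iff_tendsto_eLpNorm' _ _).1 hV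
    refine tendsto_of_tendsto_of_tendsto_of_le_of_le tendsto_const_nhds h
      (fun _ => zero_le) fun n => ?_
    refine eLpNorm_mono_ae ?_
    filter_upwards [(hY n).coeFn_toLp] with ω hω
    rw [Pi.sub_apply, Pi.sub_apply, hω]
    exact (Y n ω - V ω).norm_coe_le_norm t
  -- the process is itself `L⁴`-continuous in time, so the interpolations converge to it pointwise
  have l2 : Filter.Tendsto (fun n => eLpNorm ((fun ω => Y n ω t) - X t) 4 P)
      Filter.atTop (nhds 0) := by
    have hr : Filter.Tendsto (fun n : ℕ => ENNReal.ofReal (√√(2 * C * T ^ 2) * √(1 / 2) ^ n))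
        Filter.atTop (nhds 0) := by
      have h := (tendsto_pow_atTop_nhds_zero_of_lt_one (Real.sqrt_nonneg (1 / 2))
        (by rw [Real.sqrt_lt' one_pos]; norm_num)).const_mul √√(2 * C * T ^ 2)
      rw [mul_zero] at h
      simpa using ENNReal.tendsto_ofReal h
    refine tendsto_of_tendsto_of_tendsto_of_le_of_le tendsto_const_nhds hr
      (fun _ => zero_le) fun n => ?_
    refine eLpNorm_four_le_ofReal (by positivity) ?_
    obtain ⟨k, hk, hk', hpt⟩ := dyadicPath_sub_le hT n t
    have hD : (√√(2 * C * T ^ 2) * √(1 / 2) ^ n) ^ 4 =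
        C * (T / 2 ^ n) ^ 2 + C * (T / 2 ^ n) ^ 2 := by
      have h4 : √(1 / 2 : ℝ) ^ 4 = 1 / 4 := by
        rw [(by norm_num : 4 = 2 * 2), pow_mul, Real.sq_sqrt (by norm_num)]
        norm_num
      rw [mul_pow, ← pow_mul, mul_comm n, pow_mul, sqrt_sqrt_pow_four (by positivity), h4,
        div_pow, div_pow, ← pow_mul, mul_comm n, pow_mul]
      norm_num
      ring
    rw [hD, ENNReal.ofReal_add (by positivity) (by positivity)]
    calc _ ≤ ∫⁻ ω, (ENNReal.ofReal ((X (k * T / 2 ^ n) ω - X t ω) ^ 4) +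
            ENNReal.ofReal ((X ((k + 1 : ℕ) * T / 2 ^ n) ω - X t ω) ^ 4)) ∂P := by
          refine lintegral_mono fun ω => ?_
          rw [← ENNReal.ofReal_add (by positivity) (by positivity)]
          refine ENNReal.ofReal_le_ofReal ?_
          rw [Real.norm_eq_abs, (by decide : Even 4).pow_abs]
          exact hpt _ _
      _ = _ := lintegral_add_left' ((((hXm _).sub (hXm _)).pow_const 4).ennreal_ofReal) _
      _ ≤ _ := by
          have hsq : ∀ x : ℝ, |x| ≤ T / 2 ^ n →
              ENNReal.ofReal (C * x ^ 2) ≤ ENNReal.ofReal (C * (T / 2 ^ n) ^ 2) := fun x hx =>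
            ENNReal.ofReal_le_ofReal
              (mul_le_mul_of_nonneg_left (sq_le_sq' (abs_le.1 hx).1 (abs_le.1 hx).2) hC)
          exact add_le_add ((hinc _ _).trans (hsq _ hk)) ((hinc _ _).trans (hsq _ hk'))
  have hle : ∀ n, eLpNorm ((fun ω => V ω t) - X t) 4 P ≤
      eLpNorm ((fun ω => Y n ω t) - fun ω => V ω t) 4 P +
        eLpNorm ((fun ω => Y n ω t) - X t) 4 P := by
    intro n
    rw [eLpNorm_sub_comm (fun ω => Y n ω t)]
    have e : (fun ω => V ω t) - X t = ((fun ω => V ω t) - fun ω => Y n ω t) +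
        ((fun ω => Y n ω t) - X t) := by abel
    rw [e]
    exact eLpNorm_add_le (hVt.sub (hYt n)) ((hYt n).sub (hX t).aestronglyMeasurable) (by norm_num)
  have h0 : eLpNorm ((fun ω => V ω t) - X t) 4 P = 0 := by
    have h := ge_of_tendsto' (l1.add l2) hle
    simpa using h
  rw [eLpNorm_eq_zero_iff (hVt.sub (hX t).aestronglyMeasurable) (by norm_num)] at h0
  filter_upwards [h0] with ω hω
  exact sub_eq_zero.1 hω

end ContinuousVersion

/-! ### Existence of inputs, and well-posedness -/

section WienerPath

variable {Ω : Type*} {mΩ : MeasurableSpace Ω} {P : Measure Ω} {B : ℝ≥0 → Ω → ℝ}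

/-- The fourth moment of a centred Gaussian variable is a multiple of the square of its variance:
by scaling it suffices that the standard Gaussian law has a finite fourth moment. -/
theorem exists_lintegral_pow_four_gaussianReal :
    ∃ C : ℝ, 0 ≤ C ∧ ∀ v : ℝ≥0,
      ∫⁻ x, ENNReal.ofReal (x ^ 4) ∂gaussianReal 0 v = ENNReal.ofReal (C * v ^ 2) := by
  have hfin : ∫⁻ x, ENNReal.ofReal (x ^ 4) ∂gaussianReal 0 1 < ∞ := by
    have h := lintegral_rpow_enorm_lt_top_of_eLpNorm_lt_top (by norm_num) (by simp)
      (memLp_id_gaussianReal (μ := 0) (v := 1) 4).eLpNorm_lt_top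
    refine lt_of_le_of_lt (lintegral_mono fun x => ?_) h
    rw [← (by decide : Even 4).pow_abs, ENNReal.ofReal_pow (abs_nonneg x), ← ENNReal.rpow_natCast,
      ← Real.norm_eq_abs, ofReal_norm]
    simp
  refine ⟨(∫⁻ x, ENNReal.ofReal (x ^ 4) ∂gaussianReal 0 1).toReal, ENNReal.toReal_nonneg,
    fun v => ?_⟩
  have hv : gaussianReal 0 v = (gaussianReal 0 1).map (√v * ·) := by
    rw [gaussianReal_map_const_mul, mul_zero, mul_one]
    congr 1
    ext
    simp
  rw [hv, lintegral_map (by fun_prop) (by fun_prop), ENNReal.ofReal_mul ENNReal.toReal_nonneg,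
    ENNReal.ofReal_toReal hfin.ne, ← lintegral_mul_const _ (by fun_prop)]
  refine lintegral_congr fun x => ?_
  have h4 : √(v : ℝ) ^ 4 = v ^ 2 := by
    rw [(by norm_num : 4 = 2 * 2), pow_mul, Real.sq_sqrt v.coe_nonneg]
  rw [← ENNReal.ofReal_mul (by positivity), mul_pow, h4, mul_comm]

/-- A pre-Brownian process has, on `[0,T]`, a version with continuous paths. -/
theorem exists_wienerPath (hB : IsPreBrownianReal B P) {T : ℝ} (hT : 0 < T) :
    ∃ W : Ω → PathSpace T ℝ, Measurable W ∧ MemLp W 4 P ∧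
      ∀ t : Icc (0 : ℝ) T, (fun ω => W ω t) =ᵐ[P] B (Real.toNNReal t) := by
  obtain ⟨C, hC, h4⟩ := exists_lintegral_pow_four_gaussianReal
  refine exists_continuous_version (X := fun t => B (Real.toNNReal t)) hC
    (fun t => (hB.isGaussianProcess.hasGaussianLaw_eval _).memLp (by simp)) (fun s t => ?_) hT
  have hlaw := hB.hasLaw_sub (Real.toNNReal s) (Real.toNNReal t)
  have h : ∫⁻ ω, ENNReal.ofReal ((B (Real.toNNReal s) ω - B (Real.toNNReal t) ω) ^ 4) ∂P =
      ∫⁻ x, ENNReal.ofReal (x ^ 4) ∂P.map (B (Real.toNNReal s) - B (Real.toNNReal t)) := by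
    rw [lintegral_map' (by fun_prop) hlaw.aemeasurable]
    rfl
  rw [h, hlaw.map_eq, h4]
  refine ENNReal.ofReal_le_ofReal (mul_le_mul_of_nonneg_left ?_ hC)
  rw [coe_nndist, Real.dist_eq, sq_abs]
  refine sq_le_sq.2 ?_
  exact abs_max_sub_max_le_abs s t 0

/-- The increments of a continuous version of a pre-Brownian process are independent of the past. -/
theorem indepFun_past_increment (hB : IsPreBrownianReal B P) {T : ℝ} {W : Ω → PathSpace T ℝ}
    (hW : ∀ t : Icc (0 : ℝ) T, (fun ω => W ω t) =ᵐ[P] B (Real.toNNReal t))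
    {s t : Icc (0 : ℝ) T} (hst : s ≤ t) :
    IndepFun (fun ω (r : Iic s) => W ω r) (fun ω => W ω t - W ω s) P := by
  -- with the continuous version substituted on `[0,T]`, the path is surely a part of the process
  let B' : ℝ≥0 → Ω → ℝ := fun r ω =>
    if h : (r : ℝ) ≤ T then W ω ⟨r, r.2, h⟩ else B r ω
  have hB' : IsPreBrownianReal B' P := by
    refine hB.congr fun r => ?_
    by_cases h : (r : ℝ) ≤ T
    · filter_upwards [hW ⟨r, r.2, h⟩] with ω hω
      simp only [B', dif_pos h, hω, Real.toNNReal_coe]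
    · simp only [B', dif_neg h]
      rfl
  have hval : ∀ (r : Icc (0 : ℝ) T) ω, B' (Real.toNNReal r) ω = W ω r := by
    intro r ω
    have h : (Real.toNNReal r : ℝ) = r := Real.coe_toNNReal _ r.2.1
    have h' : (Real.toNNReal r : ℝ) ≤ T := h.le.trans r.2.2
    simp only [B', dif_pos h']
    congr 1
    exact Subtype.ext h
  have key := (hB'.indepFun_shift (Real.toNNReal s)).symm
  have h := key.comp
    (φ := fun (x : Iic (Real.toNNReal s) → ℝ) (r : Iic s) =>
      x ⟨Real.toNNReal ((r : Icc (0 : ℝ) T) : ℝ), Real.toNNReal_le_toNNReal r.2⟩)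
    (ψ := fun x : ℝ≥0 → ℝ => x (Real.toNNReal t - Real.toNNReal s))
    (measurable_pi_lambda _ fun r => measurable_pi_apply _)
    (measurable_pi_apply (X := fun _ : ℝ≥0 => ℝ) _)
  have e1 : Real.toNNReal s + (Real.toNNReal t - Real.toNNReal s) = Real.toNNReal t :=
    add_tsub_cancel_of_le (Real.toNNReal_le_toNNReal hst)
  convert h using 1
  · funext ω r
    exact (hval r ω).symm
  · funext ω
    simp only [Function.comp_apply, e1, hval]

end WienerPath

/-- An independent first component does not affect the independence of two functions of the second
component. -/
theorem indepFun_prod {Ω₁ Ω₂ E F : Type*} {m₁ : MeasurableSpace Ω₁} {m₂ : MeasurableSpace Ω₂}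
    {mE : MeasurableSpace E} {mF : MeasurableSpace F} {P₁ : Measure Ω₁} {P₂ : Measure Ω₂}
    [IsProbabilityMeasure P₁] [IsProbabilityMeasure P₂] {f : Ω₂ → E} {g : Ω₂ → F}
    (hf : Measurable f) (hg : Measurable g) (h : IndepFun f g P₂) :
    IndepFun (fun p : Ω₁ × Ω₂ => (p.1, f p.2)) (fun p => g p.2) (P₁.prod P₂) := by
  rw [indepFun_iff_measure_inter_preimage_eq_mul]
  intro S T hS hT
  have hS' : MeasurableSet ((fun p : Ω₁ × Ω₂ => (p.1, f p.2)) ⁻¹' S) := by measurability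
  have hT' : MeasurableSet ((fun p : Ω₁ × Ω₂ => g p.2) ⁻¹' T) := by measurability
  have e : (P₁.prod P₂) ((fun p : Ω₁ × Ω₂ => g p.2) ⁻¹' T) = P₂ (g ⁻¹' T) := by
    have : (fun p : Ω₁ × Ω₂ => g p.2) ⁻¹' T = univ ×ˢ (g ⁻¹' T) := by ext; simp
    rw [this, Measure.prod_prod, measure_univ, one_mul]
  rw [e, Measure.prod_apply (hS'.inter hT'), Measure.prod_apply hS',
    ← lintegral_mul_const _ (measurable_measure_prodMk_left hS')]
  refine lintegral_congr fun x => ?_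
  exact h.measure_inter_preimage_eq_mul (Prod.mk x ⁻¹' S) T (measurable_prodMk_left hS) hT

/-- The filtration generated by a measurable initial value and a measurable path. -/
def inputFiltration (M : Model) {Ω : Type*} {mΩ : MeasurableSpace Ω} {X₀ : Ω → ℝ}
    {W : Ω → PathSpace M.T ℝ} (hX : Measurable X₀) (hW : Measurable W) :
    Filtration (Icc (0 : ℝ) M.T) mΩ where
  seq := inputSigma M X₀ W
  mono' s t hst := sup_le_sup_left
    (iSup_le fun r : Iic s => le_iSup (fun r : Iic t => MeasurableSpace.comap (fun ω => W ω r)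
      inferInstance) ⟨r, le_trans (Set.mem_Iic.1 r.2) hst⟩) _
  le' t := sup_le hX.comap_le
    (iSup_le fun r : Iic t => ((measurable_eval (r : Icc (0 : ℝ) M.T)).comp hW).comap_le)

/-- Inputs exist: an initial value and an independent Wiener path on a product space, with the
filtration they generate. -/
theorem exists_isInput (M : Model) {ρ₀ : ℝ → ℝ} (hρ₀ : IsInitialDensity ρ₀) :
    ∃ (Ω : Type) (mΩ : MeasurableSpace Ω) (P : Measure Ω)
      (𝓕 : Filtration (Icc (0 : ℝ) M.T) mΩ) (X₀ : Ω → ℝ) (W : Ω → PathSpace M.T ℝ),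
      IsInput M P ρ₀ 𝓕 X₀ W ∧ MemLp W 2 P := by
  obtain ⟨Ω, mΩ, P, B, hP, hB⟩ := exists_isPreBrownianReal
  obtain ⟨W, hWm, hW4, hW⟩ := exists_wienerPath hB M.T_pos
  have := hρ₀.isProbabilityMeasure
  have hWm' : Measurable fun p : ℝ × Ω => W p.2 := hWm.comp measurable_snd
  have hsnd : MeasurePreserving Prod.snd ((densityMeasure ρ₀).prod P) P := measurePreserving_snd
  have hev : ∀ t, Measurable fun ω => W ω t := fun t => (measurable_eval t).comp hWm
  have hle : ∀ t, inputSigma M Prod.fst (fun p : ℝ × Ω => W p.2) t ≤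
      MeasurableSpace.comap (fun p : ℝ × Ω => (p.1, fun r : Iic t => W p.2 r)) inferInstance := by
    intro t
    refine sup_le ?_ (iSup_le fun r : Iic t => ?_)
    · exact (measurable_fst.comp (comap_measurable
        fun p : ℝ × Ω => (p.1, fun r : Iic t => W p.2 r))).comap_le
    · exact (((measurable_pi_apply r).comp measurable_snd).comp (comap_measurable
        fun p : ℝ × Ω => (p.1, fun r : Iic t => W p.2 r))).comap_le
  refine ⟨ℝ × Ω, inferInstance, (densityMeasure ρ₀).prod P,
    inputFiltration M measurable_fst hWm', Prod.fst, fun p => W p.2,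
    ⟨inferInstance, ⟨fun t => ?_, ?_, fun s t hst => ?_, fun s t hst => ?_⟩, ?_, ?_⟩, ?_⟩
  · exact Measurable.mono (comap_measurable _)
      (le_sup_of_le_right (le_iSup_of_le (⟨t, Set.mem_Iic.2 le_rfl⟩ : Iic t) le_rfl)) le_rfl
  · refine hsnd.quasiMeasurePreserving.ae (p := fun ω => W ω M.zero = 0) ?_
    filter_upwards [hW M.zero, hB.eval_zero_ae_eq_zero] with ω h1 h2
    rw [h1]
    simpa [Model.zero] using h2
  · have h := hB.hasLaw_sub (Real.toNNReal t) (Real.toNNReal s)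
    have h' : HasLaw (fun ω => W ω t - W ω s)
        (gaussianReal 0 (Real.toNNReal ((t : ℝ) - (s : ℝ)))) P := by
      have e : nndist (Real.toNNReal t : ℝ) (Real.toNNReal s) = Real.toNNReal ((t : ℝ) - s) := by
        rw [Real.coe_toNNReal _ t.2.1, Real.coe_toNNReal _ s.2.1]
        ext
        rw [coe_nndist, Real.dist_eq, abs_of_nonneg (sub_nonneg.2 (Subtype.coe_le_coe.2 hst)),
          Real.coe_toNNReal _ (sub_nonneg.2 (Subtype.coe_le_coe.2 hst))]
      rw [← e]
      refine h.congr ?_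
      filter_upwards [hW s, hW t] with ω h1 h2
      rw [h1, h2, Pi.sub_apply]
    exact h'.comp hsnd.hasLaw
  · exact indep_of_indep_of_le_left (indepFun_prod (P₁ := densityMeasure ρ₀)
      (measurable_pi_lambda _ fun r => hev _) ((hev t).sub (hev s))
      (indepFun_past_increment hB hW hst)) (hle s)
  · exact Measurable.mono (comap_measurable _) le_sup_left le_rfl
  · exact measurePreserving_fst.hasLaw
  · exact (hW4.mono_exponent (by norm_num)).comp_measurePreserving hsnd

/-- The driving path of every input is square integrable, since its law does not depend on the
input. -/
theorem IsInput.memLp_driver {M : Model} {ρ₀ : ℝ → ℝ} (hρ₀ : IsInitialDensity ρ₀) {Ω : Type*}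
    {mΩ : MeasurableSpace Ω} {P : Measure Ω} {𝓕 : Filtration (Icc (0 : ℝ) M.T) mΩ} {X₀ : Ω → ℝ}
    {W : Ω → PathSpace M.T ℝ} (h : IsInput M P ρ₀ 𝓕 X₀ W) : MemLp W 2 P := by
  obtain ⟨Ω', mΩ', P', 𝓕', X₀', W', h', hW'⟩ := exists_isInput M hρ₀
  have m1 := h.measurable_initial.prodMk h.measurable_driver
  have m1' := h'.measurable_initial.prodMk h'.measurable_driver
  have hs : AEStronglyMeasurable Prod.snd (P.map fun ω => (X₀ ω, W ω)) :=
    measurable_snd.aestronglyMeasurable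
  have hs' : AEStronglyMeasurable Prod.snd (P'.map fun ω => (X₀' ω, W' ω)) :=
    measurable_snd.aestronglyMeasurable
  have e := (memLp_map_measure_iff (p := 2) hs' m1'.aemeasurable).2 hW'
  rw [← h.map_eq h'] at e
  exact (memLp_map_measure_iff (p := 2) hs m1.aemeasurable).1 e

theorem IsInput.exists_isSolutionMap {M : Model} {ρ₀ : ℝ → ℝ} {Ω : Type*}
    {mΩ : MeasurableSpace Ω} {P : Measure Ω} {𝓕 : Filtration (Icc (0 : ℝ) M.T) mΩ} {X₀ : Ω → ℝ}
    {W : Ω → PathSpace M.T ℝ} (h : IsInput M P ρ₀ 𝓕 X₀ W) :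
    ∃ F, M.IsSolutionMap (P.map fun ω => (X₀ ω, W ω)) F := by
  have := h.isProbabilityMeasure
  have := Measure.isProbabilityMeasure_map (μ := P)
    (h.measurable_initial.prodMk h.measurable_driver).aemeasurable
  exact M.exists_isSolutionMap _

end KilledMcKeanVlasov
end

theorem proposition2p4 (M : Model) (ρ₀ : ℝ → ℝ)
    (hρ₀ : IsInitialDensity ρ₀) :
    -- existence of a strong solution, for every input
    (∀ (Ω : Type u) [mΩ : MeasurableSpace Ω] (P : Measure Ω)
        (𝓕 : Filtration (Icc (0 : ℝ) M.T) mΩ)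
        (X₀ : Ω → ℝ) (W : Ω → PathSpace M.T ℝ),
        IsInput M P ρ₀ 𝓕 X₀ W →
        ∃ Z : Ω → PathSpace M.T (ℝ × ℝ),
          IsStrongSolution M P 𝓕 X₀ W Z) ∧
    -- pathwise uniqueness, also for solutions relative to different filtrations
    (∀ (Ω : Type u) [mΩ : MeasurableSpace Ω] (P : Measure Ω)
        (𝓕 𝓖 : Filtration (Icc (0 : ℝ) M.T) mΩ)
        (X₀ : Ω → ℝ) (W : Ω → PathSpace M.T ℝ)
        (Z Z' : Ω → PathSpace M.T (ℝ × ℝ)),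
        IsInput M P ρ₀ 𝓕 X₀ W →
        IsInput M P ρ₀ 𝓖 X₀ W →
        IsSolution M P 𝓕 X₀ W Z →
        IsSolution M P 𝓖 X₀ W Z' →
        ∀ᵐ ω ∂P, ∀ t, Z ω t = Z' ω t) ∧
    -- existence of a weak solution
    (∃ (Ω : Type) (_ : MeasurableSpace Ω) (P : Measure Ω)
        (Z : Ω → PathSpace M.T (ℝ × ℝ)),
        IsWeakSolution M P ρ₀ Z) ∧
    -- uniqueness in law of weak solutions
    (∀ (Ω : Type u) (Ω' : Type v) [MeasurableSpace Ω] [MeasurableSpace Ω']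
        (P : Measure Ω) (P' : Measure Ω')
        (Z : Ω → PathSpace M.T (ℝ × ℝ))
        (Z' : Ω' → PathSpace M.T (ℝ × ℝ)),
        IsWeakSolution M P ρ₀ Z →
        IsWeakSolution M P' ρ₀ Z' →
        P.map Z = P'.map Z') := by
  refine ⟨fun Ω mΩ P 𝓕 X₀ W hin => ?_, fun Ω mΩ P 𝓕 𝓖 X₀ W Z Z' hin _ hZ hZ' => ?_, ?_,
    fun Ω Ω' _ _ P P' Z Z' => ?_⟩
  · obtain ⟨F, hF⟩ := hin.exists_isSolutionMap
    exact ⟨_, hF.isStrongSolution hρ₀ hin (hin.memLp_driver hρ₀)⟩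
  · have := hin.isProbabilityMeasure
    exact hZ.ae_eq hZ'
  · obtain ⟨Ω, mΩ, P, 𝓕, X₀, W, hin, hW⟩ := exists_isInput M hρ₀
    obtain ⟨F, hF⟩ := hin.exists_isSolutionMap
    exact ⟨Ω, mΩ, P, _, 𝓕, X₀, W, hin, (hF.isStrongSolution hρ₀ hin hW).toIsSolution⟩
  · rintro ⟨𝓕, X₀, W, hin, hZ⟩ ⟨𝓕', X₀', W', hin', hZ'⟩
    -- both solutions are images of the same input law under the same solution map
    obtain ⟨F, hF⟩ := hin.exists_isSolutionMap
    have hlaw := hin.map_eq hin'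
    rw [hZ.map_eq hρ₀ hin (hin.memLp_driver hρ₀) hF,
      hZ'.map_eq hρ₀ hin' (hin'.memLp_driver hρ₀) (hlaw ▸ hF), hlaw]
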